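/- **Theorem 8 (the rotation connection is not $S^2$-flat).** Let $m\ge 0$ and let $E$ be a particle bundle of mass $m$: a smooth Hermitian vector bundle of finite nonzero rank over the momentum space $M=\mathbb{R}^3$ (if $m>0$) or $M=\mathbb{R}^3\setminus\{0\}$ (if $m=0$), with a smooth, fibrewise linear, unitary, irreducible action $\Sigma$ of the proper orthochronous Poincaré group $\mathrm{ISO}^+(3,1)$ that covers the standard action on the 4-momenta $(\omega,\mathbf{k})$, $\omega=\sqrt{m^2+|\mathbf{k}|^2}$, and in which the translation by $a$ acts on $E(\mathbf{k})$ as the phase $e^{i(\omega a^0-\mathbf{k}\cdot\mathbf{a})}$. For sections $\psi$ put $(\tilde\Sigma_g\psi)(\mathbf{k})=\Sigma_g[\psi(g^{-1}\mathbf{k})]$, $J_a\psi=i\frac{d}{dt}\big|_{0}\tilde\Sigma_{R_a(t)}\psi$, $K_a\psi=-i\frac{d}{dt}\big|_{0}\tilde\Sigma_{\Lambda_a(t)}\psi$, with $R_a(t)$ the rotations about, and $\Lambda_a(t)$ the boosts along, the $a$-th axis, and let $\mathbf{P}$ and $H$ be multiplication by $\mathbf{k}$ and $\omega$. On the restriction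 $\tilde E$ of $E$ to $\mathbb{R}^3\setminus\{0\}$ consider the rotation connection $$\mathbf{D}^R=-i\Big(\frac{\hat{\mathbf{P}}\times\mathbf{J}}{|\mathbf{P}|}+\frac1H\hat{\mathbf{P}}(\hat{\mathbf{P}}\cdot\mathbf{K})-\frac{i\mathbf{P}}{2H^2}\Big),$$ where $D^R_X=X\cdot\mathbf{D}^R$ for vector fields $X$, with curvature $F^R(X,Y)=D^R_XD^R_Y-D^R_YD^R_X-D^R_{[X,Y]}$. Then $\mathbf{D}^R$ is a connection on $\tilde E$, and its $S^2$-curvature is $$F^R(\mathbf{e}_\theta,\mathbf{e}_\phi)=\frac{i J_k}{|\mathbf{P}|^2},\qquad J_k=\hat{\mathbf{k}}\cdot\mathbf{J},$$ where $\mathbf{e}_\theta,\mathbf{e}_\phi$ are the spherical unit vector fields (defined off the polar axis). Suppose moreover that the particle has nonzero spin ($m>0$) or nonzero helicity ($m=0$), that is, for some $\mathbf{k}\in M$ the little group $\{L\in\mathrm{SO}^+(3,1): L\mathbf{k}=\mathbf{k}\}$ acts nontrivially on $E(\mathbf{k})$. Then $\mathbf{D}^R$ is not $S^2$-flat: $F^R(X,Y)$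 does not vanish for all smooth vector fields $X,Y$ on $\mathbb{R}^3\setminus\{0\}$ orthogonal to $\mathbf{k}$. Moreover, $\mathbf{D}^R$ does not induce a splitting of $\mathbf{J}$ into spin and orbital angular momentum (SAM-OAM): neither $\mathbf{L}^R=-i\mathbf{k}\times\mathbf{D}^R$ nor $\mathbf{S}^R=\mathbf{J}-\mathbf{L}^R$ satisfies the angular momentum relations $[A_a,A_b]=i\epsilon_{abc}A_c$ on smooth sections of $\tilde E$. -/

import Mathlib

open scoped Manifold ContDiff
open Bundle

/-! ### The proper orthochronous Lorentz group and the Poincare group -/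

namespace Relativity

/-- The Minkowski metric `diag(1, -1, -1, -1)`; index `0` is time. -/
def minkowski : Matrix (Fin 4) (Fin 4) ℝ := Matrix.diagonal ![1, -1, -1, -1]

lemma minkowski_mul_self : minkowski * minkowski = 1 := by
  ext i j; fin_cases i <;> fin_cases j <;> simp [minkowski, Matrix.diagonal, Matrix.mul_apply]

lemma minkowski_transpose : minkowski.transpose = minkowski := Matrix.diagonal_transpose _

lemma lorentz_row {L : Matrix (Fin 4) (Fin 4) ℝ} (h : L.transpose * minkowski * L = minkowski) :
    L 0 0 ^ 2 = 1 + L 0 1 ^ 2 + L 0 2 ^ 2 + L 0 3 ^ 2 := by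
  have h1 : (minkowski * L.transpose * minkowski) * L = 1 := by
    rw [mul_assoc, mul_assoc, ← mul_assoc L.transpose, h, minkowski_mul_self]
  have h2 := mul_eq_one_comm.mp h1
  have h3 : L * minkowski * L.transpose = minkowski := by
    calc L * minkowski * L.transpose
        = (L * (minkowski * L.transpose * minkowski)) * minkowski := by
          simp only [mul_assoc, minkowski_mul_self, mul_one]
      _ = minkowski := by rw [h2, one_mul]
  have h4 := congrFun (congrFun h3 0) 0
  simp [minkowski, Matrix.mul_apply, Fin.sum_univ_four, Matrix.diagonal] at h4
  linarith

lemma lorentz_forward {L : Matrix (Fin 4) (Fin 4) ℝ}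
    (h : L.transpose * minkowski * L = minkowski) (h0 : 0 < L 0 0) {p : Fin 4 → ℝ}
    (hp : 0 < p 0) (hp2 : p 1 ^ 2 + p 2 ^ 2 + p 3 ^ 2 ≤ p 0 ^ 2) : 0 < L.mulVec p 0 := by
  have hr := lorentz_row h
  have e : L.mulVec p 0 = L 0 0 * p 0 + (L 0 1 * p 1 + L 0 2 * p 2 + L 0 3 * p 3) := by
    simp [Matrix.mulVec, dotProduct, Fin.sum_univ_four]; ring
  rw [e]
  by_contra hc
  push Not at hc
  set b := L 0 1 * p 1 + L 0 2 * p 2 + L 0 3 * p 3 with hb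
  have hap : 0 < L 0 0 * p 0 := mul_pos h0 hp
  have h1 : (L 0 0 * p 0) ^ 2 ≤ b ^ 2 := by nlinarith
  have h2 : b ^ 2 ≤ (L 0 1 ^ 2 + L 0 2 ^ 2 + L 0 3 ^ 2) * (p 1 ^ 2 + p 2 ^ 2 + p 3 ^ 2) := by
    rw [hb]
    nlinarith [sq_nonneg (L 0 1 * p 2 - L 0 2 * p 1), sq_nonneg (L 0 1 * p 3 - L 0 3 * p 1),
      sq_nonneg (L 0 2 * p 3 - L 0 3 * p 2)]
  have h3 : (L 0 1 ^ 2 + L 0 2 ^ 2 + L 0 3 ^ 2) * (p 1 ^ 2 + p 2 ^ 2 + p 3 ^ 2)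
      ≤ (L 0 1 ^ 2 + L 0 2 ^ 2 + L 0 3 ^ 2) * p 0 ^ 2 :=
    mul_le_mul_of_nonneg_left hp2 (by positivity)
  have h4 : (L 0 0 * p 0) ^ 2 = (1 + L 0 1 ^ 2 + L 0 2 ^ 2 + L 0 3 ^ 2) * p 0 ^ 2 := by
    rw [mul_pow, hr]
  have h5 : 0 < p 0 ^ 2 := by positivity
  nlinarith

/-- The Minkowski square is preserved. -/
lemma lorentz_sq {L : Matrix (Fin 4) (Fin 4) ℝ}
    (h : L.transpose * minkowski * L = minkowski) (p : Fin 4 → ℝ) :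
    L.mulVec p 0 ^ 2 - L.mulVec p 1 ^ 2 - L.mulVec p 2 ^ 2 - L.mulVec p 3 ^ 2
      = p 0 ^ 2 - p 1 ^ 2 - p 2 ^ 2 - p 3 ^ 2 := by
  have q : ∀ v : Fin 4 → ℝ, v ⬝ᵥ minkowski.mulVec v
      = v 0 ^ 2 - v 1 ^ 2 - v 2 ^ 2 - v 3 ^ 2 := by
    intro v
    simp [minkowski, Matrix.mulVec_diagonal, dotProduct, Fin.sum_univ_four]; ring
  rw [← q, ← q]
  conv_rhs => rw [← h]
  rw [← Matrix.mulVec_mulVec, ← Matrix.mulVec_mulVec, Matrix.dotProduct_mulVec p,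
    Matrix.vecMul_transpose]

/-- The proper orthochronous Lorentz group `SO⁺(3,1)`. -/
def LorentzGroup : Subgroup (Matrix.SpecialLinearGroup (Fin 4) ℝ) where
  carrier := {L | (L : Matrix (Fin 4) (Fin 4) ℝ).transpose * minkowski * L = minkowski ∧ 0 < L 0 0}
  one_mem' := by simp
  mul_mem' := by
    rintro A B ⟨hA, hA0⟩ ⟨hB, hB0⟩
    refine ⟨?_, ?_⟩
    · rw [Matrix.SpecialLinearGroup.coe_mul, Matrix.transpose_mul]
      calc _ = (B : Matrix (Fin 4) (Fin 4) ℝ).transpose *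
            ((A : Matrix (Fin 4) (Fin 4) ℝ).transpose * minkowski * A) * B := by
              simp only [mul_assoc]
        _ = _ := by rw [hA, hB]
    · have e : (A * B : Matrix.SpecialLinearGroup (Fin 4) ℝ) 0 0
          = (A : Matrix (Fin 4) (Fin 4) ℝ).mulVec (fun i => B i 0) 0 := by
        simp [Matrix.mulVec, dotProduct, Matrix.mul_apply]
      rw [e]
      refine lorentz_forward hA hA0 hB0 ?_
      have h4 := congrFun (congrFun hB 0) 0
      simp [minkowski, Matrix.mul_apply, Fin.sum_univ_four, Matrix.diagonal] at h4
      nlinarith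
  inv_mem' := by
    rintro A ⟨hA, hA0⟩
    have h1 : (minkowski * (A : Matrix (Fin 4) (Fin 4) ℝ).transpose * minkowski) * A = 1 := by
      rw [mul_assoc, mul_assoc, ← mul_assoc (A : Matrix (Fin 4) (Fin 4) ℝ).transpose, hA,
        minkowski_mul_self]
    have h2 : (A : Matrix (Fin 4) (Fin 4) ℝ) * ((A⁻¹ : Matrix.SpecialLinearGroup (Fin 4) ℝ) :
        Matrix (Fin 4) (Fin 4) ℝ) = 1 := by
      rw [← Matrix.SpecialLinearGroup.coe_mul]; simp
    have h3 : ((A⁻¹ : Matrix.SpecialLinearGroup (Fin 4) ℝ) : Matrix (Fin 4) (Fin 4) ℝ)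
        = minkowski * (A : Matrix (Fin 4) (Fin 4) ℝ).transpose * minkowski :=
      (left_inv_eq_right_inv h1 h2).symm
    refine ⟨?_, ?_⟩
    · rw [h3]
      have h1' := mul_eq_one_comm.mp h1
      calc _ = minkowski * (A * (minkowski *
            (A : Matrix (Fin 4) (Fin 4) ℝ).transpose * minkowski)) := by
              simp only [Matrix.transpose_mul, Matrix.transpose_transpose, minkowski_transpose,
                mul_assoc]
              rw [← mul_assoc minkowski minkowski, minkowski_mul_self, one_mul]
        _ = _ := by rw [h1', mul_one]
    · rw [h3]
      simpa [minkowski, Matrix.diagonal_mul, Matrix.mul_diagonal] using hA0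

lemma mem_LorentzGroup (L : Matrix.SpecialLinearGroup (Fin 4) ℝ) :
    L ∈ LorentzGroup ↔ (L : Matrix (Fin 4) (Fin 4) ℝ).transpose * minkowski * L = minkowski ∧
      0 < L 0 0 := Iff.rfl

/-- The proper orthochronous Poincare group `ISO⁺(3,1)`: the pair `(a, L)` is the transformation
`x ↦ L x + a` of Minkowski space. -/
@[ext] structure PoincareGroup where
  transl : Fin 4 → ℝ
  lor : LorentzGroup

namespace PoincareGroup

/-- The matrix of the homogeneous part. -/
def mat (g : PoincareGroup) : Matrix (Fin 4) (Fin 4) ℝ :=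
  (g.lor : Matrix.SpecialLinearGroup (Fin 4) ℝ)

instance : Mul PoincareGroup := ⟨fun g h => ⟨g.transl + g.mat.mulVec h.transl, g.lor * h.lor⟩⟩
instance : One PoincareGroup := ⟨⟨0, 1⟩⟩
instance : Inv PoincareGroup :=
  ⟨fun g => ⟨-(mat ⟨0, g.lor⁻¹⟩).mulVec g.transl, g.lor⁻¹⟩⟩

lemma mul_mat (g h : PoincareGroup) : (g * h).mat = g.mat * h.mat := rfl
lemma one_mat : (1 : PoincareGroup).mat = 1 := rfl

instance : Group PoincareGroup where
  mul_assoc g h k := by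
    ext1
    · change (g.transl + g.mat.mulVec h.transl) + (g * h).mat.mulVec k.transl
        = g.transl + g.mat.mulVec (h.transl + h.mat.mulVec k.transl)
      rw [mul_mat, Matrix.mulVec_add, Matrix.mulVec_mulVec, add_assoc]
    · exact mul_assoc g.lor h.lor k.lor
  one_mul g := by
    ext1
    · change 0 + (1 : PoincareGroup).mat.mulVec g.transl = g.transl
      rw [one_mat, Matrix.one_mulVec, zero_add]
    · exact one_mul g.lor
  mul_one g := by
    ext1
    · change g.transl + g.mat.mulVec 0 = g.transl
      rw [Matrix.mulVec_zero, add_zero]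
    · exact mul_one g.lor
  inv_mul_cancel g := by
    ext1
    · change -(mat ⟨0, g.lor⁻¹⟩).mulVec g.transl + (mat ⟨0, g.lor⁻¹⟩).mulVec g.transl = 0
      simp
    · exact inv_mul_cancel g.lor

end PoincareGroup

/-! ### Rotations and boosts -/

/-- The rotation by the angle `t` about the `a`-th coordinate axis (right hand rule). -/
noncomputable def rotationMatrix : Fin 3 → ℝ → Matrix (Fin 4) (Fin 4) ℝ
  | 0, t => !![1, 0, 0, 0; 0, 1, 0, 0; 0, 0, Real.cos t, -Real.sin t; 0, 0, Real.sin t, Real.cos t]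
  | 1, t => !![1, 0, 0, 0; 0, Real.cos t, 0, Real.sin t; 0, 0, 1, 0; 0, -Real.sin t, 0, Real.cos t]
  | 2, t => !![1, 0, 0, 0; 0, Real.cos t, -Real.sin t, 0; 0, Real.sin t, Real.cos t, 0; 0, 0, 0, 1]

/-- The boost along the `a`-th coordinate axis with rapidity `t`
(velocity `tanh t`, which is `t` to first order). -/
noncomputable def boostMatrix : Fin 3 → ℝ → Matrix (Fin 4) (Fin 4) ℝ
  | 0, t => !![Real.cosh t, Real.sinh t, 0, 0; Real.sinh t, Real.cosh t, 0, 0; 0, 0, 1, 0;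
      0, 0, 0, 1]
  | 1, t => !![Real.cosh t, 0, Real.sinh t, 0; 0, 1, 0, 0; Real.sinh t, 0, Real.cosh t, 0;
      0, 0, 0, 1]
  | 2, t => !![Real.cosh t, 0, 0, Real.sinh t; 0, 1, 0, 0; 0, 0, 1, 0;
      Real.sinh t, 0, 0, Real.cosh t]

lemma rotationMatrix_det (a : Fin 3) (t : ℝ) : (rotationMatrix a t).det = 1 := by
  have := Real.sin_sq_add_cos_sq t
  fin_cases a <;>
    simp [rotationMatrix, Matrix.det_succ_row_zero, Fin.sum_univ_succ, Fin.succAbove] <;>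
    nlinarith

lemma boostMatrix_det (a : Fin 3) (t : ℝ) : (boostMatrix a t).det = 1 := by
  have := Real.cosh_sq t
  fin_cases a <;>
    simp [boostMatrix, Matrix.det_succ_row_zero, Fin.sum_univ_succ, Fin.succAbove] <;>
    nlinarith

lemma rotationMatrix_mem (a : Fin 3) (t : ℝ) :
    (⟨rotationMatrix a t, rotationMatrix_det a t⟩ : Matrix.SpecialLinearGroup (Fin 4) ℝ)
      ∈ LorentzGroup := by
  have := Real.sin_sq_add_cos_sq t
  refine (mem_LorentzGroup _).mpr ⟨?_, ?_⟩
  · ext i j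
    fin_cases a <;> fin_cases i <;> fin_cases j <;>
      simp [rotationMatrix, minkowski, Matrix.mul_apply, Fin.sum_univ_four, Matrix.diagonal] <;>
      nlinarith
  · fin_cases a <;> simp [rotationMatrix]

lemma boostMatrix_mem (a : Fin 3) (t : ℝ) :
    (⟨boostMatrix a t, boostMatrix_det a t⟩ : Matrix.SpecialLinearGroup (Fin 4) ℝ)
      ∈ LorentzGroup := by
  have := Real.cosh_sq t
  refine (mem_LorentzGroup _).mpr ⟨?_, ?_⟩
  · ext i j
    fin_cases a <;> fin_cases i <;> fin_cases j <;>
      simp [boostMatrix, minkowski, Matrix.mul_apply, Fin.sum_univ_four, Matrix.diagonal] <;>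
      nlinarith
  · fin_cases a <;> simp [boostMatrix, Real.cosh_pos]

/-- `R_a(t)` as an element of the Poincare group. -/
noncomputable def rotation (a : Fin 3) (t : ℝ) : PoincareGroup :=
  ⟨0, ⟨⟨rotationMatrix a t, rotationMatrix_det a t⟩, rotationMatrix_mem a t⟩⟩

/-- `Λ_a(t)` as an element of the Poincare group. -/
noncomputable def boost (a : Fin 3) (t : ℝ) : PoincareGroup :=
  ⟨0, ⟨⟨boostMatrix a t, boostMatrix_det a t⟩, boostMatrix_mem a t⟩⟩

/-! ### Momentum space -/

/-- Euclidean 3-space. -/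
abbrev Space : Type := EuclideanSpace ℝ (Fin 3)

/-- The mass `m` hyperboloid (`m ≠ 0`) or the forward light cone without its vertex (`m = 0`),
labelled by the spatial momentum: `ℝ³`, respectively `ℝ³ \ {0}`. -/
def momentumSpace (m : ℝ) : TopologicalSpace.Opens Space where
  carrier := {k | m = 0 → k ≠ 0}
  is_open' := by
    by_cases h : m = 0
    · have e : {k : Space | m = 0 → k ≠ 0} = {0}ᶜ := by ext k; simp [h]
      rw [e]; exact isOpen_compl_singleton
    · simp [h]

/-- The energy `ω = √(m² + |k|²)`. -/
noncomputable def energy (m : ℝ) (k : Space) : ℝ := Real.sqrt (m ^ 2 + ‖k‖ ^ 2)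

/-- The 4-momentum `(ω, k)`. -/
noncomputable def fourMomentum (m : ℝ) (k : Space) : Fin 4 → ℝ :=
  ![energy m k, k 0, k 1, k 2]

/-- The spatial part of a 4-vector. -/
def spatial (p : Fin 4 → ℝ) : Space := !₂[p 1, p 2, p 3]

lemma space_norm_sq (k : Space) : ‖k‖ ^ 2 = k 0 ^ 2 + k 1 ^ 2 + k 2 ^ 2 := by
  simp [EuclideanSpace.norm_sq_eq, Fin.sum_univ_three]

lemma energy_sq (m : ℝ) (k : Space) : energy m k ^ 2 = m ^ 2 + ‖k‖ ^ 2 :=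
  Real.sq_sqrt (by positivity)

lemma energy_pos {m : ℝ} (k : momentumSpace m) : 0 < energy m k := by
  apply Real.sqrt_pos.mpr
  by_cases h : m = 0
  · have : (k : Space) ≠ 0 := k.2 h
    have := norm_pos_iff.mpr this
    positivity
  · positivity

/-- Poincare transformations map on-shell momenta to on-shell momenta. -/
lemma fourMomentum_spatial {m : ℝ} (g : PoincareGroup) (k : momentumSpace m) :
    fourMomentum m (spatial (g.mat.mulVec (fourMomentum m k))) = g.mat.mulVec (fourMomentum m k)
      ∧ 0 < g.mat.mulVec (fourMomentum m k) 0 := by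
  have hk := energy_sq m k
  have hn := space_norm_sq (k : Space)
  obtain ⟨hg1, hg2⟩ := (mem_LorentzGroup _).mp g.lor.2
  have hpos : 0 < g.mat.mulVec (fourMomentum m k) 0 := by
    refine lorentz_forward hg1 hg2 (energy_pos k) ?_
    simp only [fourMomentum, Matrix.cons_val]
    nlinarith [sq_nonneg m]
  refine ⟨?_, hpos⟩
  have hs := lorentz_sq hg1 (fourMomentum m k)
  change g.mat.mulVec (fourMomentum m k) 0 ^ 2 - g.mat.mulVec (fourMomentum m k) 1 ^ 2
    - g.mat.mulVec (fourMomentum m k) 2 ^ 2 - g.mat.mulVec (fourMomentum m k) 3 ^ 2 = _ at hs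
  set q := g.mat.mulVec (fourMomentum m k) with hq
  have e0 : energy m (spatial q) = q 0 := by
    rw [energy, Real.sqrt_eq_iff_mul_self_eq (by positivity) hpos.le, space_norm_sq]
    simp only [spatial, PiLp.toLp_apply, Matrix.cons_val]
    simp only [fourMomentum, Matrix.cons_val] at hs
    nlinarith
  ext i
  fin_cases i
  · exact e0
  all_goals simp [fourMomentum, spatial]

/-- The standard action of the Poincare group on momenta: translations act trivially and the
homogeneous part acts on the 4-momentum `(ω, k)`. -/
noncomputable instance {m : ℝ} : MulAction PoincareGroup (momentumSpace m) where
  smul g k := ⟨spatial (g.mat.mulVec (fourMomentum m k)), by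
    intro hm h0
    obtain ⟨h1, h2⟩ := fourMomentum_spatial g k
    rw [h0] at h1
    rw [← h1] at h2
    simp [fourMomentum, energy, hm] at h2⟩
  one_smul k := by
    apply Subtype.ext
    change spatial ((1 : PoincareGroup).mat.mulVec (fourMomentum m k)) = k
    rw [PoincareGroup.one_mat, Matrix.one_mulVec]
    ext i
    fin_cases i <;> simp [spatial, fourMomentum]
  mul_smul g h k := by
    apply Subtype.ext
    change spatial ((g * h).mat.mulVec (fourMomentum m k))
      = spatial (g.mat.mulVec (fourMomentum m (spatial (h.mat.mulVec (fourMomentum m k)))))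
    rw [(fourMomentum_spatial h k).1, PoincareGroup.mul_mat, Matrix.mulVec_mulVec]

/-! ### Vector fields on momentum space without the origin -/

/-- A smooth vector field on `ℝ³ \ {0}` (its value at the origin is irrelevant). -/
def SmoothField (X : Space → Space) : Prop := ContDiffOn ℝ ∞ X {0}ᶜ

/-- The cross product of vectors of `ℝ³`. -/
def cross (u v : Space) : Space := WithLp.toLp 2 (crossProduct (WithLp.ofLp u) (WithLp.ofLp v))

/-- The `a`-th standard basis vector of `ℝ³`. -/
noncomputable def basisVec (a : Fin 3) : Space := EuclideanSpace.single a 1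

/-- The radial unit vector field `k / |k|`. -/
noncomputable def eRadial (k : Space) : Space := ‖k‖⁻¹ • k

/-- The polar angle `θ` of `k`. -/
noncomputable def polarAngle (k : Space) : ℝ := Real.arccos (k 2 / ‖k‖)

/-- The azimuthal angle `φ` of `k`. -/
noncomputable def azimuth (k : Space) : ℝ := Complex.arg ⟨k 0, k 1⟩

/-- The spherical unit vector field in the direction of increasing `θ`. -/
noncomputable def eTheta (k : Space) : Space :=
  !₂[Real.cos (polarAngle k) * Real.cos (azimuth k),
     Real.cos (polarAngle k) * Real.sin (azimuth k), -Real.sin (polarAngle k)]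

/-- The spherical unit vector field in the direction of increasing `φ`. -/
noncomputable def ePhi (k : Space) : Space :=
  !₂[-Real.sin (azimuth k), Real.cos (azimuth k), 0]

/-! ### Sections, connections and curvature

`E` is a complex vector bundle over the momentum space of mass `m`. A section of its restriction to
`ℝ³ \ {0}` is represented by a section of `E` whose value at the origin (if the origin belongs to
the momentum space) is irrelevant. -/

section Connections

variable {m : ℝ} (F : Type*) [NormedAddCommGroup F] [NormedSpace ℂ F]
  {E : momentumSpace m → Type*} [∀ k, NormedAddCommGroup (E k)]
  [∀ k, InnerProductSpace ℂ (E k)] [TopologicalSpace (TotalSpace F E)] [FiberBundle F E]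

/-- `ψ` is a smooth section of the restriction of `E` to `ℝ³ \ {0}`. -/
def SmoothSection (ψ : ∀ k, E k) : Prop :=
  ContMDiffOn 𝓘(ℝ, Space) (𝓘(ℝ, Space).prod 𝓘(ℝ, F)) ∞
    (fun k : momentumSpace m => TotalSpace.mk' F k (ψ k)) {k | (k : Space) ≠ 0}

/-- `D`, written `(X, ψ) ↦ D_X ψ`, is a connection on the restriction of `E` to `ℝ³ \ {0}`. -/
structure IsConnection (D : (Space → Space) → (∀ k, E k) → ∀ k, E k) : Prop where
  smooth : ∀ X ψ, SmoothField X → SmoothSection F ψ → SmoothSection F (D X ψ)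
  add_field : ∀ X Y ψ, SmoothField X → SmoothField Y → SmoothSection F ψ →
    ∀ k : momentumSpace m, (k : Space) ≠ 0 → D (X + Y) ψ k = D X ψ k + D Y ψ k
  smul_field : ∀ (f : Space → ℝ) X ψ, ContDiffOn ℝ ∞ f {0}ᶜ → SmoothField X →
    SmoothSection F ψ → ∀ k : momentumSpace m, (k : Space) ≠ 0 →
      D (fun x => f x • X x) ψ k = (f k : ℂ) • D X ψ k
  add_section : ∀ X ψ χ, SmoothField X → SmoothSection F ψ → SmoothSection F χ →
    ∀ k : momentumSpace m, (k : Space) ≠ 0 →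
      D X (fun q => ψ q + χ q) k = D X ψ k + D X χ k
  leibniz : ∀ (f : Space → ℂ) X ψ, ContDiffOn ℝ ∞ f {0}ᶜ → SmoothField X →
    SmoothSection F ψ → ∀ k : momentumSpace m, (k : Space) ≠ 0 →
      D X (fun q => f q • ψ q) k = (fderiv ℝ f k (X k)) • ψ k + f k • D X ψ k


/-- The curvature `F(X, Y) ψ = (D_X D_Y - D_Y D_X - D_[X,Y]) ψ`. -/
noncomputable def curvature (D : (Space → Space) → (∀ k, E k) → ∀ k, E k) (X Y : Space → Space)
    (ψ : ∀ k, E k) (k : momentumSpace m) : E k :=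
  D X (D Y ψ) k - D Y (D X ψ) k - D (VectorField.lieBracket ℝ X Y) ψ k

/-- `D` is `S²`-flat: its curvature vanishes on all vector fields transverse to `k`, that is,
tangent to the spheres around the origin. -/
def S2Flat (D : (Space → Space) → (∀ k, E k) → ∀ k, E k) : Prop :=
  ∀ X Y : Space → Space, SmoothField X → SmoothField Y →
    (∀ k, k ≠ 0 → inner ℝ (X k) k = 0) → (∀ k, k ≠ 0 → inner ℝ (Y k) k = 0) →
    ∀ ψ : ∀ k, E k, SmoothSection F ψ → ∀ k : momentumSpace m, (k : Space) ≠ 0 →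
      curvature D X Y ψ k = 0

/-- For a vector `A = (A₀, A₁, A₂)` of operators and a vector field `X`, the operator
`X · A = Σ Xₐ Aₐ`. -/
noncomputable def dotOp (X : Space → Space) (A : Fin 3 → (∀ k, E k) → ∀ k, E k)
    (ψ : ∀ k, E k) (k : momentumSpace m) : E k :=
  ∑ a, (X k a : ℂ) • A a ψ k

/-- The operators `A₀, A₁, A₂` satisfy the angular momentum relations `[Aₐ, A_b] = i ε_{abc} A_c`
on smooth sections over `ℝ³ \ {0}`. (By antisymmetry these are the three relations
`[Aₐ, Aₐ₊₁] = i Aₐ₊₂`, with indices modulo 3.) -/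
def IsAngularMomentum (A : Fin 3 → (∀ k, E k) → ∀ k, E k) : Prop :=
  ∀ (a : Fin 3) (ψ : ∀ k, E k), SmoothSection F ψ → ∀ k : momentumSpace m, (k : Space) ≠ 0 →
    A a (A (a + 1) ψ) k - A (a + 1) (A a ψ) k = Complex.I • A (a + 2) ψ k

/-- The orbital part `L^D = -i k × D` of the splitting induced by `D`:
`Lₐ = -i eₐ · (k × D) = -i D_{eₐ × k}`. -/
noncomputable def orbital (D : (Space → Space) → (∀ k, E k) → ∀ k, E k) (a : Fin 3)
    (ψ : ∀ k, E k) (k : momentumSpace m) : E k :=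
  -Complex.I • D (fun q => cross (basisVec a) q) ψ k

/-- The spin part `S^D = J - L^D` of the splitting of `J` induced by `D`. -/
noncomputable def spin (J : Fin 3 → (∀ k, E k) → ∀ k, E k)
    (D : (Space → Space) → (∀ k, E k) → ∀ k, E k) (a : Fin 3)
    (ψ : ∀ k, E k) (k : momentumSpace m) : E k :=
  J a ψ k - orbital D a ψ k

end Connections

/-! ### Particle bundles -/

section Particles

/-- A smooth family of Poincare transformations with `n` real parameters. -/
def SmoothFamily {n : ℕ} (g : EuclideanSpace ℝ (Fin n) → PoincareGroup) : Prop :=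
  (∀ i, ContDiff ℝ ∞ fun x => (g x).transl i) ∧ ∀ i j, ContDiff ℝ ∞ fun x => (g x).mat i j

/-- A unitary irreducible action `Σ` of `ISO⁺(3,1)` on a Hermitian vector bundle `E` over the
momentum space of mass `m`, covering the standard action on momenta.
For `g • k = k'`, the map `Σ_g : E(k) → E(k')` is `act g k k' _`. -/
structure ParticleBundle (m : ℝ) (F : Type*) [NormedAddCommGroup F] [NormedSpace ℂ F]
    (E : momentumSpace m → Type*) [∀ k, NormedAddCommGroup (E k)]
    [∀ k, InnerProductSpace ℂ (E k)] [TopologicalSpace (TotalSpace F E)] [FiberBundle F E] where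
  act : ∀ (g : PoincareGroup) (k k' : momentumSpace m), g • k = k' → E k →ₗ[ℂ] E k'
  /-- the inner product of the fibres depends smoothly on the base point -/
  smooth_inner : ∀ ψ χ : ∀ k, E k,
    ContMDiff 𝓘(ℝ, Space) (𝓘(ℝ, Space).prod 𝓘(ℝ, F)) ∞
      (fun k : momentumSpace m => TotalSpace.mk' F k (ψ k)) →
    ContMDiff 𝓘(ℝ, Space) (𝓘(ℝ, Space).prod 𝓘(ℝ, F)) ∞
      (fun k : momentumSpace m => TotalSpace.mk' F k (χ k)) →
    ContMDiff 𝓘(ℝ, Space) 𝓘(ℝ, ℂ) ∞ (fun k : momentumSpace m => inner ℂ (ψ k) (χ k))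
  act_one : ∀ k (v : E k), act 1 k k (one_smul _ k) v = v
  act_mul : ∀ g h k k' k'' (hk : h • k = k') (hk' : g • k' = k'') (v : E k),
    act (g * h) k k'' (by rw [mul_smul, hk, hk']) v = act g k' k'' hk' (act h k k' hk v)
  inner_act : ∀ g k k' (hk : g • k = k') (v w : E k),
    inner ℂ (act g k k' hk v) (act g k k' hk w) = inner ℂ v w
  /-- the action is smooth: smooth families of group elements act smoothly on the total space -/
  smooth_act : ∀ (n : ℕ) (g : EuclideanSpace ℝ (Fin n) → PoincareGroup), SmoothFamily g →
    ContMDiff (𝓘(ℝ, EuclideanSpace ℝ (Fin n)).prod (𝓘(ℝ, Space).prod 𝓘(ℝ, F)))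
      (𝓘(ℝ, Space).prod 𝓘(ℝ, F)) ∞
      (fun z : EuclideanSpace ℝ (Fin n) × TotalSpace F E =>
        TotalSpace.mk' F (g z.1 • z.2.proj) (act (g z.1) z.2.proj _ rfl z.2.snd))
  /-- translations act on the states of 4-momentum `(ω, k)` by the phase `exp(i(ω a⁰ - k · a))` -/
  act_transl : ∀ (a : Fin 4 → ℝ) k (hk : (⟨a, 1⟩ : PoincareGroup) • k = k) (v : E k),
    act ⟨a, 1⟩ k k hk v = Complex.exp (Complex.I *
      ((energy m k * a 0 - ((k : Space) 0 * a 1 + (k : Space) 1 * a 2 + (k : Space) 2 * a 3) : ℝ)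
        : ℂ)) • v
  /-- the bundle has nonzero rank -/
  nontrivial : ∀ k, Nontrivial (E k)
  /-- irreducibility; since the action on momenta is transitive, an invariant family of subspaces
  is automatically a smooth subbundle -/
  irreducible : ∀ V : ∀ k, Submodule ℂ (E k),
    (∀ g k k' (hk : g • k = k') (v : E k), v ∈ V k → act g k k' hk v ∈ V k') →
    (∀ k, V k = ⊥) ∨ (∀ k, V k = ⊤)

namespace ParticleBundle

variable {m : ℝ} {F : Type*} [NormedAddCommGroup F] [NormedSpace ℂ F]
  {E : momentumSpace m → Type*} [∀ k, NormedAddCommGroup (E k)]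
  [∀ k, InnerProductSpace ℂ (E k)] [TopologicalSpace (TotalSpace F E)] [FiberBundle F E]
  (B : ParticleBundle m F E)

/-- The induced action on sections, `(Σ̃_g ψ)(k) = Σ_g (ψ(g⁻¹ k))`. -/
noncomputable def onSections (g : PoincareGroup) (ψ : ∀ k, E k) (k : momentumSpace m) : E k :=
  B.act g (g⁻¹ • k) k (smul_inv_smul g k) (ψ (g⁻¹ • k))

/-- The angular momentum operators `Jₐ ψ = i d/dt|₀ Σ̃_{Rₐ(t)} ψ`. -/
noncomputable def J (a : Fin 3) (ψ : ∀ k, E k) (k : momentumSpace m) : E k :=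
  Complex.I • deriv (fun t : ℝ => B.onSections (rotation a t) ψ k) 0

/-- The boost operators `Kₐ ψ = -i d/dt|₀ Σ̃_{Λₐ(t)} ψ`. -/
noncomputable def K (a : Fin 3) (ψ : ∀ k, E k) (k : momentumSpace m) : E k :=
  -Complex.I • deriv (fun t : ℝ => B.onSections (boost a t) ψ k) 0

/-- The rotation connection
`D^R = -i ( (P̂ × J) / |P| + H⁻¹ P̂ (P̂ · K) - i P / (2 H²) )`,
where `X · (P̂ × J) = (X × P̂) · J`, and `P`, `H` multiply by `k`, `ω`. -/
noncomputable def rotationConnection (X : Space → Space) (ψ : ∀ k, E k) (k : momentumSpace m) :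
    E k :=
  -Complex.I •
    (((‖(k : Space)‖⁻¹ : ℝ) : ℂ) • dotOp (fun q => cross (X q) (eRadial q)) B.J ψ k
      + (((energy m k)⁻¹ * inner ℝ (X k) (eRadial k) : ℝ) : ℂ) • dotOp eRadial B.K ψ k
      - (Complex.I * ((inner ℝ (X k) (k : Space) / (2 * energy m k ^ 2) : ℝ) : ℂ)) • ψ k)

/-- The particle is scalar, that is, its spin (`m > 0`) or helicity (`m = 0`) is zero: the
representations of the little groups `{L ∈ SO⁺(3,1) | L k = k}` on the fibres `E(k)`
are trivial. -/
def IsScalar : Prop :=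
  ∀ (L : LorentzGroup) (k : momentumSpace m) (hk : (⟨0, L⟩ : PoincareGroup) • k = k) (v : E k),
    B.act ⟨0, L⟩ k k hk v = v

end ParticleBundle

end Particles

end Relativity

open Relativity

/-! For a field `X` tangent to the spheres the boost term and the scalar term of `D^R` drop out,
both being proportional to `X · k`. What remains is `D_X = i v_X · J` with `v_X = k × X / |k|²`. Two
facts then determine the curvature on spheres: the Leibniz rule, by which `J` acts on coefficients
as `-i k × ∇`, and the relations `[J_a, J_b] = i ε_{abc} J_c`. Derivatives of the coefficients
contribute `2 (X × Y) / |k|²` besides `v_[X,Y]`, the commutator of the `J`'s removes one copy, and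
`F(X, Y) = (i / |k|²) (X × Y) · J` is left (`curvature_rotationConnection`). For the spherical frame
`X × Y` is the radial unit vector.

The negative statements are all tested at points of the polar axis with the global tangent fields
`e_a × k`. There `F(e₀ × k, e₁ × k) = i J₂`, the difference `[L₀, L₁] - i L₂` is `-F(e₀ × k, e₁ ×
k)`, and `S₀ = S₁ = 0` while `S₂ = J₂`. Hence flatness, or either set of angular momentum relations,
forces `J₂ = 0` on the axis.

This makes the particle scalar (`isScalar_of_J_two_eq_zero`). A one-parameter group with zero
generator is trivial, so rotations about the axis act trivially on the fibres over it. Triviality is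
inherited by products and conjugates, and such rotations reach every little group. For `m = 0` the
little group consists of axis rotations and null rotations, and null rotations are commutators with
a half turn. For `m > 0` a boost along the axis, which commutes with axis rotations, carries
triviality to the rest momentum, where Euler angles give all of `SO(3)`.

The analytic input is that `Σ̃_g ψ` is jointly smooth in the momentum and in the parameters of `g`.
The relations for `J` follow from symmetry of second derivatives and a rotation-equivariant chart of
`SO(3)`. -/

namespace Relativity

/-! ### Smooth dependence of the action on sections -/

section BundleAnalysis

variable {m : ℝ} {F : Type*} [NormedAddCommGroup F] [NormedSpace ℂ F]
  {E : momentumSpace m → Type*} [∀ k, NormedAddCommGroup (E k)]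
  [∀ k, InnerProductSpace ℂ (E k)] [TopologicalSpace (TotalSpace F E)] [FiberBundle F E]

/-- In this form the entries of the inverse are linear in those of `g`, so inverses of smooth
families are smooth. -/
lemma PoincareGroup.mat_inv (g : PoincareGroup) :
    (g⁻¹).mat = minkowski * g.mat.transpose * minkowski := by
  have h1 : (minkowski * g.mat.transpose * minkowski) * g.mat = 1 := by
    rw [mul_assoc, mul_assoc, ← mul_assoc g.mat.transpose]
    have := ((mem_LorentzGroup _).mp g.lor.2).1
    change g.mat.transpose * minkowski * g.mat = minkowski at this
    rw [this, minkowski_mul_self]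
  have h2 : g.mat * (g⁻¹).mat = 1 := by
    rw [← PoincareGroup.mul_mat, mul_inv_cancel, PoincareGroup.one_mat]
  exact (left_inv_eq_right_inv h1 h2).symm

lemma SmoothFamily.inv {n : ℕ} {g : EuclideanSpace ℝ (Fin n) → PoincareGroup}
    (hg : SmoothFamily g) : SmoothFamily fun x => (g x)⁻¹ := by
  obtain ⟨h1, h2⟩ := hg
  have h3 : ∀ i j, ContDiff ℝ ∞ fun x => ((g x)⁻¹).mat i j := by
    intro i j
    simp only [PoincareGroup.mat_inv, Matrix.mul_apply, Matrix.transpose_apply]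
    exact ContDiff.sum fun b _ =>
      (ContDiff.sum fun c _ => contDiff_const.mul (h2 _ _)).mul contDiff_const
  refine ⟨fun i => ?_, h3⟩
  have e : (fun x => ((g x)⁻¹).transl i) =
      fun x => (-(((g x)⁻¹).mat.mulVec (g x).transl)) i := by
    funext x
    rfl
  rw [e]
  simp only [Pi.neg_apply, Matrix.mulVec, dotProduct]
  exact (ContDiff.sum fun b _ => (h3 _ _).mul (h1 _)).neg

lemma ParticleBundle.act_congr (B : ParticleBundle m F E) {g h : PoincareGroup} (e : g = h)
    {k k' : momentumSpace m} (hk : g • k = k') (v : E k) :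
    B.act g k k' hk v = B.act h k k' (e ▸ hk) v := by
  subst e; rfl

/-- Links `smooth_act`, phrased with target `g • k`, to targets known only up to a proof of
equality. -/
lemma ParticleBundle.mk_act_eq (B : ParticleBundle m F E) (g : PoincareGroup)
    {k k' : momentumSpace m} (hk : g • k = k') (v : E k) :
    TotalSpace.mk' F (g • k) (B.act g k _ rfl v) = TotalSpace.mk' F k' (B.act g k k' hk v) := by
  subst hk; rfl

lemma ParticleBundle.norm_act (B : ParticleBundle m F E) (g : PoincareGroup)
    {k k' : momentumSpace m} (hk : g • k = k') (v : E k) : ‖B.act g k k' hk v‖ = ‖v‖ := by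
  rw [@norm_eq_sqrt_re_inner ℂ, @norm_eq_sqrt_re_inner ℂ, B.inner_act]

/-- The action `Σ_g : E(k) → E(k')` as a continuous real linear map. -/
noncomputable def ParticleBundle.actL (B : ParticleBundle m F E) (g : PoincareGroup)
    (k k' : momentumSpace m) (hk : g • k = k') : E k →L[ℝ] E k' :=
  LinearMap.mkContinuous ((B.act g k k' hk).restrictScalars ℝ) 1
    fun v => by simpa using (B.norm_act g hk v).le

lemma ParticleBundle.actL_apply (B : ParticleBundle m F E) (g : PoincareGroup)
    {k k' : momentumSpace m} (hk : g • k = k') (v : E k) :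
    B.actL g k k' hk v = B.act g k k' hk v := rfl

lemma ParticleBundle.onSections_mul (B : ParticleBundle m F E) (g h : PoincareGroup)
    (ψ : ∀ k, E k) : B.onSections (g * h) ψ = B.onSections g (B.onSections h ψ) := by
  funext k
  unfold onSections
  -- The two base points are equal only propositionally and the fibres depend on them; generalizing
  -- the point permits substitution.
  have key : ∀ q (hq : q = h⁻¹ • g⁻¹ • k), ∀ hk, B.act (g * h) q k hk (ψ q) =
      B.act g (g⁻¹ • k) k (smul_inv_smul g k) (B.act h (h⁻¹ • g⁻¹ • k) (g⁻¹ • k)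
        (smul_inv_smul h _) (ψ (h⁻¹ • g⁻¹ • k))) := by
    rintro q rfl hk
    exact B.act_mul g h _ _ _ (smul_inv_smul h _) (smul_inv_smul g k) _
  exact key _ (by rw [mul_inv_rev, mul_smul]) _

lemma ParticleBundle.onSections_one (B : ParticleBundle m F E) (ψ : ∀ k, E k) :
    B.onSections 1 ψ = ψ := by
  funext k
  unfold onSections
  have key : ∀ q (hq : q = k), ∀ hk, B.act 1 q k hk (ψ q) = ψ k := by
    rintro q rfl hk
    exact B.act_one _ _
  exact key _ (by simp) _

lemma ParticleBundle.onSections_of_fixed (B : ParticleBundle m F E) (g : PoincareGroup)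
    (ψ : ∀ k, E k) {k : momentumSpace m} (hk : g • k = k) :
    B.onSections g ψ k = B.act g k k hk (ψ k) := by
  unfold onSections
  have key : ∀ q (hq : q = k) hk', B.act g q k hk' (ψ q) = B.act g k k hk (ψ k) := by
    rintro q rfl hk'; rfl
  exact key _ (by rw [inv_smul_eq_iff, hk]) _

variable [VectorBundle ℝ F E]

/-- The action on momenta is the action on the total space, restricted to the zero section and
projected to the base. -/
lemma ParticleBundle.contMDiff_smul (B : ParticleBundle m F E) {n : ℕ}
    {g : EuclideanSpace ℝ (Fin n) → PoincareGroup} (hg : SmoothFamily g) :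
    ContMDiff (𝓘(ℝ, EuclideanSpace ℝ (Fin n)).prod 𝓘(ℝ, Space)) 𝓘(ℝ, Space) ∞
      (fun z : EuclideanSpace ℝ (Fin n) × momentumSpace m => g z.1 • z.2) := by
  have h0 : ContMDiff (𝓘(ℝ, EuclideanSpace ℝ (Fin n)).prod 𝓘(ℝ, Space))
      (𝓘(ℝ, EuclideanSpace ℝ (Fin n)).prod (𝓘(ℝ, Space).prod 𝓘(ℝ, F))) ∞
      (fun z : EuclideanSpace ℝ (Fin n) × momentumSpace m => (z.1, zeroSection F E z.2)) :=
    contMDiff_fst.prodMk ((contMDiff_zeroSection ℝ E).comp contMDiff_snd)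
  exact (contMDiff_proj E).comp ((B.smooth_act n g hg).comp h0)

/-- A composite of smooth maps: move the point by the inverse, evaluate `ψ`, act. The hypothesis
`hk` is needed because a boost may carry `k` to the origin, where nothing is known about `ψ`. -/
lemma ParticleBundle.contMDiffAt_onSections (B : ParticleBundle m F E) {n : ℕ}
    {g : EuclideanSpace ℝ (Fin n) → PoincareGroup} (hg : SmoothFamily g)
    {ψ : ∀ k, E k} (hψ : SmoothSection F ψ) (x : EuclideanSpace ℝ (Fin n)) (k : momentumSpace m)
    (hk : (((g x)⁻¹ • k : momentumSpace m) : Space) ≠ 0) :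
    ContMDiffAt (𝓘(ℝ, Space).prod 𝓘(ℝ, EuclideanSpace ℝ (Fin n)))
      (𝓘(ℝ, Space).prod 𝓘(ℝ, F)) ∞
      (fun z : momentumSpace m × EuclideanSpace ℝ (Fin n) =>
        TotalSpace.mk' F z.1 (B.onSections (g z.2) ψ z.1)) (k, x) := by
  have hopen : IsOpen {k : momentumSpace m | (k : Space) ≠ 0} :=
    isOpen_compl_singleton.preimage continuous_subtype_val
  have h1 : ContMDiffAt (𝓘(ℝ, Space).prod 𝓘(ℝ, EuclideanSpace ℝ (Fin n))) 𝓘(ℝ, Space) ∞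
      (fun z : momentumSpace m × EuclideanSpace ℝ (Fin n) => (g z.2)⁻¹ • z.1) (k, x) :=
    ((B.contMDiff_smul hg.inv).comp (contMDiff_snd.prodMk contMDiff_fst)).contMDiffAt
  have h2 : ContMDiffAt 𝓘(ℝ, Space) (𝓘(ℝ, Space).prod 𝓘(ℝ, F)) ∞
      (fun k : momentumSpace m => TotalSpace.mk' F k (ψ k)) ((g x)⁻¹ • k) :=
    (hψ _ hk).contMDiffAt (hopen.mem_nhds hk)
  have h3 : ContMDiffAt (𝓘(ℝ, Space).prod 𝓘(ℝ, EuclideanSpace ℝ (Fin n)))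
      (𝓘(ℝ, Space).prod 𝓘(ℝ, F)) ∞
      (fun z : momentumSpace m × EuclideanSpace ℝ (Fin n) =>
        TotalSpace.mk' F ((g z.2)⁻¹ • z.1) (ψ ((g z.2)⁻¹ • z.1))) (k, x) :=
    ContMDiffAt.comp (k, x) (g := fun k : momentumSpace m => TotalSpace.mk' F k (ψ k)) h2 h1
  have h4 := ContMDiffAt.comp (k, x) (B.smooth_act n g hg).contMDiffAt
    ((contMDiff_snd.contMDiffAt).prodMk h3)
  refine h4.congr_of_eventuallyEq (Filter.Eventually.of_forall fun z => ?_)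
  exact (B.mk_act_eq (g z.2) (smul_inv_smul (g z.2) z.1) _).symm

lemma ParticleBundle.contDiffAt_onSections (B : ParticleBundle m F E) {n : ℕ}
    {g : EuclideanSpace ℝ (Fin n) → PoincareGroup} (hg : SmoothFamily g)
    {ψ : ∀ k, E k} (hψ : SmoothSection F ψ) (x : EuclideanSpace ℝ (Fin n)) (k : momentumSpace m)
    (hk : (((g x)⁻¹ • k : momentumSpace m) : Space) ≠ 0) :
    ContDiffAt ℝ ∞ (fun y => B.onSections (g y) ψ k) x := by
  have h1 : ContMDiffAt 𝓘(ℝ, EuclideanSpace ℝ (Fin n))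
      (𝓘(ℝ, Space).prod 𝓘(ℝ, F)) ∞
      (fun y => TotalSpace.mk' F k (B.onSections (g y) ψ k)) x :=
    ContMDiffAt.comp x (f := fun y => (k, y)) (B.contMDiffAt_onSections hg hψ x k hk)
      (contMDiffAt_const.prodMk contMDiffAt_id)
  have h2 := (contMDiffAt_totalSpace.mp h1).2
  rw [contMDiffAt_iff_contDiffAt] at h2
  -- The trivialization identifies `E k` with `F` by a continuous linear isomorphism, so smoothness
  -- in coordinates is smoothness in the norm of the fibre.
  have hb := FiberBundle.mem_baseSet_trivializationAt' (F := F) (E := E) k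
  have h3 := ((trivializationAt F E k).continuousLinearEquivAt ℝ k hb).symm.contDiff.contDiffAt.comp
    x h2
  refine h3.congr_of_eventuallyEq (Filter.Eventually.of_forall fun y => ?_)
  symm
  exact ((trivializationAt F E k).continuousLinearEquivAt ℝ k hb).symm_apply_apply _

/-- In a trivialization this is a partial derivative of a jointly smooth function, hence smooth in
the other variable; fibrewise linearity of the trivialization lets it pass through the derivative.
-/
lemma ParticleBundle.contMDiffAt_fderiv_onSections (B : ParticleBundle m F E) {n : ℕ}
    {g : EuclideanSpace ℝ (Fin n) → PoincareGroup} (hg : SmoothFamily g)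
    {ψ : ∀ k, E k} (hψ : SmoothSection F ψ) (x v : EuclideanSpace ℝ (Fin n)) (k : momentumSpace m)
    (hk : (((g x)⁻¹ • k : momentumSpace m) : Space) ≠ 0) :
    ContMDiffAt 𝓘(ℝ, Space) (𝓘(ℝ, Space).prod 𝓘(ℝ, F)) ∞
      (fun k : momentumSpace m =>
        TotalSpace.mk' F k (fderiv ℝ (fun y => B.onSections (g y) ψ k) x v)) k := by
  rw [contMDiffAt_section]
  set e := trivializationAt F E k
  have h1 := (contMDiffAt_totalSpace.mp (B.contMDiffAt_onSections hg hψ x k hk)).2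
  have h2 := ContMDiffAt.mfderiv (n := ∞) (m := ∞)
    (fun (q : momentumSpace m) (y : EuclideanSpace ℝ (Fin n)) =>
      (e (TotalSpace.mk' F q (B.onSections (g y) ψ q))).2) (fun _ => x) h1 contMDiffAt_const
      (by simp)
  have h3 : ContMDiffAt 𝓘(ℝ, Space) 𝓘(ℝ, F) ∞ (fun q : momentumSpace m =>
      fderiv ℝ (fun y => (e (TotalSpace.mk' F q (B.onSections (g y) ψ q))).2) x v) k := by
    have h4 := h2.clm_apply (contMDiffAt_const (c := v))
    simpa only [inTangentCoordinates_model_space, mfderiv_eq_fderiv] using h4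
  have hopen : IsOpen {k : momentumSpace m | (k : Space) ≠ 0} :=
    isOpen_compl_singleton.preimage continuous_subtype_val
  have hc : Continuous fun q : momentumSpace m => (g x)⁻¹ • q :=
    ((B.contMDiff_smul hg.inv).comp
      ((contMDiff_const (c := x)).prodMk contMDiff_id)).continuous
  refine h3.congr_of_eventuallyEq ?_
  filter_upwards [e.open_baseSet.mem_nhds (FiberBundle.mem_baseSet_trivializationAt' k),
    (hopen.preimage hc).mem_nhds hk] with q hq hq'
  have hd := (B.contDiffAt_onSections hg hψ x q hq').differentiableAt (by simp)
  have h5 := ((e.continuousLinearEquivAt ℝ q hq).toContinuousLinearMap.hasFDerivAt.comp x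
    hd.hasFDerivAt).fderiv
  change _ = fderiv ℝ (⇑(e.continuousLinearEquivAt ℝ q hq).toContinuousLinearMap ∘
    fun y => B.onSections (g y) ψ q) x v
  rw [h5]
  rfl

end BundleAnalysis

/-! ### Rotations, boosts and the Cayley chart -/

section Families

lemma PoincareGroup.ext_mat {g h : PoincareGroup} (h1 : g.transl = h.transl) (h2 : g.mat = h.mat) :
    g = h := by
  ext1
  · exact h1
  · exact Subtype.ext (Subtype.ext h2)

lemma PoincareGroup.mul_transl (g h : PoincareGroup) :
    (g * h).transl = g.transl + g.mat.mulVec h.transl := rfl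

lemma rotation_mat (a : Fin 3) (t : ℝ) : (rotation a t).mat = rotationMatrix a t := rfl

lemma boost_mat (a : Fin 3) (t : ℝ) : (boost a t).mat = boostMatrix a t := rfl

lemma rotation_transl (a : Fin 3) (t : ℝ) : (rotation a t).transl = 0 := rfl

lemma boost_transl (a : Fin 3) (t : ℝ) : (boost a t).transl = 0 := rfl

lemma rotation_add (a : Fin 3) (s t : ℝ) :
    rotation a (s + t) = rotation a s * rotation a t := by
  refine PoincareGroup.ext_mat ?_ ?_
  · simp [PoincareGroup.mul_transl, rotation_transl]
  · rw [PoincareGroup.mul_mat, rotation_mat, rotation_mat, rotation_mat]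
    fin_cases a <;> ext i j <;> fin_cases i <;> fin_cases j <;>
      simp [rotationMatrix, Matrix.mul_apply, Fin.sum_univ_four, Real.cos_add, Real.sin_add] <;>
      ring

lemma rotation_zero (a : Fin 3) : rotation a 0 = 1 := by
  refine PoincareGroup.ext_mat rfl ?_
  rw [PoincareGroup.one_mat, rotation_mat]
  fin_cases a <;> ext i j <;> fin_cases i <;> fin_cases j <;> simp [rotationMatrix]

lemma rotation_inv (a : Fin 3) (t : ℝ) : (rotation a t)⁻¹ = rotation a (-t) := by
  rw [inv_eq_iff_mul_eq_one, ← rotation_add, add_neg_cancel, rotation_zero]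

lemma boost_add (a : Fin 3) (s t : ℝ) : boost a (s + t) = boost a s * boost a t := by
  refine PoincareGroup.ext_mat ?_ ?_
  · simp [PoincareGroup.mul_transl, boost_transl]
  · rw [PoincareGroup.mul_mat, boost_mat, boost_mat, boost_mat]
    fin_cases a <;> ext i j <;> fin_cases i <;> fin_cases j <;>
      simp [boostMatrix, Matrix.mul_apply, Fin.sum_univ_four, Real.cosh_add, Real.sinh_add] <;>
      ring

lemma boost_zero (a : Fin 3) : boost a 0 = 1 := by
  refine PoincareGroup.ext_mat rfl ?_
  rw [PoincareGroup.one_mat, boost_mat]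
  fin_cases a <;> ext i j <;> fin_cases i <;> fin_cases j <;> simp [boostMatrix]

lemma boost_inv (a : Fin 3) (t : ℝ) : (boost a t)⁻¹ = boost a (-t) := by
  rw [inv_eq_iff_mul_eq_one, ← boost_add, add_neg_cancel, boost_zero]

/-- The Cayley parametrization of the rotations: `y` is the vector part of the quaternion `1 + y`,
which acts by a rotation about `y` by the angle `2 arctan |y|`. -/
noncomputable def cayleyMatrix (y : Space) : Matrix (Fin 4) (Fin 4) ℝ :=
  (1 + (y 0 ^ 2 + y 1 ^ 2 + y 2 ^ 2))⁻¹ •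
    !![1 + (y 0 ^ 2 + y 1 ^ 2 + y 2 ^ 2), 0, 0, 0;
      0, 1 + y 0 ^ 2 - y 1 ^ 2 - y 2 ^ 2, 2 * (y 0 * y 1 - y 2), 2 * (y 0 * y 2 + y 1);
      0, 2 * (y 0 * y 1 + y 2), 1 - y 0 ^ 2 + y 1 ^ 2 - y 2 ^ 2, 2 * (y 1 * y 2 - y 0);
      0, 2 * (y 0 * y 2 - y 1), 2 * (y 1 * y 2 + y 0), 1 - y 0 ^ 2 - y 1 ^ 2 + y 2 ^ 2]

lemma det_block_one_three (w a b c p q r u v x : ℝ) :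
    (!![w, 0, 0, 0; 0, a, b, c; 0, p, q, r; 0, u, v, x] : Matrix (Fin 4) (Fin 4) ℝ).det
      = w * (a * (q * x - r * v) - b * (p * x - r * u) + c * (p * v - q * u)) := by
  simp [Matrix.det_succ_row_zero, Fin.sum_univ_succ, Fin.succAbove]
  left
  ring

lemma cayleyMatrix_det (y : Space) : (cayleyMatrix y).det = 1 := by
  have hd : (1 + (y 0 ^ 2 + y 1 ^ 2 + y 2 ^ 2))⁻¹ * (1 + (y 0 ^ 2 + y 1 ^ 2 + y 2 ^ 2)) = 1 :=
    inv_mul_cancel₀ (by positivity)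
  have key : ∀ x y z : ℝ, (1 + x ^ 2 - y ^ 2 - z ^ 2) *
      ((1 - x ^ 2 + y ^ 2 - z ^ 2) * (1 - x ^ 2 - y ^ 2 + z ^ 2)
        - 2 * (y * z - x) * (2 * (y * z + x)))
      - 2 * (x * y - z) * (2 * (x * y + z) * (1 - x ^ 2 - y ^ 2 + z ^ 2)
        - 2 * (y * z - x) * (2 * (x * z - y)))
      + 2 * (x * z + y) * (2 * (x * y + z) * (2 * (y * z + x))
        - (1 - x ^ 2 + y ^ 2 - z ^ 2) * (2 * (x * z - y))) = (1 + (x ^ 2 + y ^ 2 + z ^ 2)) ^ 3 := by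
    intro x y z
    ring
  rw [cayleyMatrix, Matrix.det_smul, det_block_one_three, key, ← pow_succ', Fintype.card_fin,
    ← mul_pow, hd, one_pow]

lemma cayleyMatrix_mem (y : Space) :
    (⟨cayleyMatrix y, cayleyMatrix_det y⟩ : Matrix.SpecialLinearGroup (Fin 4) ℝ)
      ∈ LorentzGroup := by
  have hd : (1 + (y 0 ^ 2 + y 1 ^ 2 + y 2 ^ 2))⁻¹ * (1 + (y 0 ^ 2 + y 1 ^ 2 + y 2 ^ 2)) = 1 :=
    inv_mul_cancel₀ (by positivity)
  refine (mem_LorentzGroup _).mpr ⟨?_, ?_⟩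
  · change (cayleyMatrix y).transpose * minkowski * cayleyMatrix y = minkowski
    rw [cayleyMatrix]
    set d := (1 + (y 0 ^ 2 + y 1 ^ 2 + y 2 ^ 2))⁻¹
    have h2 : (d * (1 + (y 0 ^ 2 + y 1 ^ 2 + y 2 ^ 2))) ^ 2 = 1 := by rw [hd]; simp
    ext i j
    fin_cases i <;> fin_cases j <;>
      simp [minkowski, Matrix.mul_apply, Fin.sum_univ_four, Matrix.diagonal] <;>
      first | ring1 | linear_combination h2 | linear_combination -h2
  · change 0 < cayleyMatrix y 0 0
    simp only [cayleyMatrix, Matrix.smul_apply, smul_eq_mul]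
    change 0 < (1 + (y 0 ^ 2 + y 1 ^ 2 + y 2 ^ 2))⁻¹ * (1 + (y 0 ^ 2 + y 1 ^ 2 + y 2 ^ 2))
    rw [hd]
    exact one_pos

/-- The Cayley parametrization of the rotations, as elements of the Poincare group. -/
noncomputable def cayley (y : Space) : PoincareGroup :=
  ⟨0, ⟨⟨cayleyMatrix y, cayleyMatrix_det y⟩, cayleyMatrix_mem y⟩⟩

lemma cayley_mat (y : Space) : (cayley y).mat = cayleyMatrix y := rfl

lemma cayley_transl (y : Space) : (cayley y).transl = 0 := rfl

lemma cayley_zero : cayley 0 = 1 := by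
  refine PoincareGroup.ext_mat rfl ?_
  rw [PoincareGroup.one_mat, cayley_mat]
  ext i j; fin_cases i <;> fin_cases j <;> simp [cayleyMatrix]

/-- The quaternion `cos (t/2) + sin (t/2) e_a` is proportional to `1 + tan (t/2) e_a`, except for
half turns, which lie outside the chart. -/
lemma rotation_eq_cayley (a : Fin 3) {t : ℝ} (ht : Real.cos (t / 2) ≠ 0) :
    rotation a t = cayley (Real.tan (t / 2) • basisVec a) := by
  refine PoincareGroup.ext_mat rfl ?_
  rw [rotation_mat, cayley_mat]
  have h1 := Real.cos_sq_add_sin_sq (t / 2)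
  have hc : Real.cos t = Real.cos (t / 2) ^ 2 - Real.sin (t / 2) ^ 2 := by
    rw [← Real.cos_two_mul']; ring_nf
  have hs : Real.sin t = 2 * Real.sin (t / 2) * Real.cos (t / 2) := by
    rw [← Real.sin_two_mul]; ring_nf
  have hd : (1 + Real.tan (t / 2) ^ 2)⁻¹ = Real.cos (t / 2) ^ 2 := by
    rw [Real.inv_one_add_tan_sq ht]
  have h2 : Real.cos (t / 2) * Real.tan (t / 2) = Real.sin (t / 2) := by
    rw [mul_comm, Real.tan_mul_cos ht]
  have h3 : Real.cos (t / 2) ^ 2 * (1 + Real.tan (t / 2) ^ 2) = 1 := by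
    rw [mul_add, ← mul_pow, h2]; linarith
  fin_cases a <;> ext i j <;> fin_cases i <;> fin_cases j <;>
    simp [rotationMatrix, cayleyMatrix, basisVec, hd, hc, hs] <;>
    (try rw [← h2]) <;> first | ring1 | linear_combination h3 | linear_combination -h3

lemma SmoothFamily.of_homogeneous {n : ℕ} {g : EuclideanSpace ℝ (Fin n) → PoincareGroup}
    (h0 : ∀ x, (g x).transl = 0) (h : ∀ i j, ContDiff ℝ ∞ fun x => (g x).mat i j) :
    SmoothFamily g := by
  refine ⟨fun i => ?_, h⟩
  simp only [h0]
  exact contDiff_const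

lemma smoothFamily_rotation {n : ℕ} (a : Fin 3) {f : EuclideanSpace ℝ (Fin n) → ℝ}
    (hf : ContDiff ℝ ∞ f) : SmoothFamily fun x => rotation a (f x) := by
  refine .of_homogeneous (fun _ => rfl) fun i j => ?_
  simp only [rotation_mat]
  have h1 := hf.cos
  have h2 := hf.sin
  fin_cases a <;> fin_cases i <;> fin_cases j <;> simp [rotationMatrix] <;>
    first | exact contDiff_const | exact h1 | exact h2 | exact h2.neg

lemma smoothFamily_boost {n : ℕ} (a : Fin 3) {f : EuclideanSpace ℝ (Fin n) → ℝ}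
    (hf : ContDiff ℝ ∞ f) : SmoothFamily fun x => boost a (f x) := by
  refine .of_homogeneous (fun _ => rfl) fun i j => ?_
  simp only [boost_mat]
  have h1 := hf.cosh
  have h2 := hf.sinh
  fin_cases a <;> fin_cases i <;> fin_cases j <;> simp [boostMatrix] <;>
    first | exact contDiff_const | exact h1 | exact h2

lemma smoothFamily_cayley : SmoothFamily cayley := by
  refine .of_homogeneous (fun _ => rfl) fun i j => ?_
  simp only [cayley_mat]
  have hx : ∀ i : Fin 3, ContDiff ℝ ∞ fun y : Space => y i := fun i => by fun_prop
  have hd : ContDiff ℝ ∞ fun y : Space => (1 + (y 0 ^ 2 + y 1 ^ 2 + y 2 ^ 2))⁻¹ :=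
    ContDiff.inv (by fun_prop) fun y => by positivity
  fin_cases i <;> fin_cases j <;> simp only [cayleyMatrix, Matrix.smul_apply, smul_eq_mul] <;>
    refine hd.mul ?_ <;> simp <;> fun_prop

lemma SmoothFamily.mul {n : ℕ} {g h : EuclideanSpace ℝ (Fin n) → PoincareGroup}
    (hg : SmoothFamily g) (hh : SmoothFamily h) : SmoothFamily fun x => g x * h x := by
  refine ⟨fun i => ?_, fun i j => ?_⟩
  · simp only [PoincareGroup.mul_transl, Pi.add_apply, Matrix.mulVec, dotProduct]
    exact (hg.1 i).add (ContDiff.sum fun b _ => (hg.2 _ _).mul (hh.1 _))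
  · simp only [PoincareGroup.mul_mat, Matrix.mul_apply]
    exact ContDiff.sum fun b _ => (hg.2 _ _).mul (hh.2 _ _)

lemma smoothFamily_const {n : ℕ} (g : PoincareGroup) :
    SmoothFamily fun _ : EuclideanSpace ℝ (Fin n) => g :=
  ⟨fun _ => contDiff_const, fun _ _ => contDiff_const⟩

/-- Conjugating a rotation by `R` applies `R` to its axis. Conjugation is thus linear in the Cayley
chart, which is the reason for choosing it. -/
lemma rotation_mul_cayley (a : Fin 3) (t : ℝ) (y : Space) :
    rotation a t * cayley y =
      cayley (spatial ((rotationMatrix a t).mulVec ![0, y 0, y 1, y 2])) * rotation a t := by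
  refine PoincareGroup.ext_mat ?_ ?_
  · simp [PoincareGroup.mul_transl, rotation_transl, cayley_transl]
  rw [PoincareGroup.mul_mat, PoincareGroup.mul_mat, rotation_mat, cayley_mat, cayley_mat]
  have h1 := Real.cos_sq_add_sin_sq t
  set z := spatial ((rotationMatrix a t).mulVec ![0, y 0, y 1, y 2]) with hz
  -- Rotations preserve length, so the denominators on the two sides agree and only polynomial
  -- entries remain to be compared.
  have hn : z 0 ^ 2 + z 1 ^ 2 + z 2 ^ 2 = y 0 ^ 2 + y 1 ^ 2 + y 2 ^ 2 := by
    fin_cases a <;> simp [hz, spatial, rotationMatrix, Matrix.mulVec, dotProduct,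
      Fin.sum_univ_four] <;> grind
  rw [cayleyMatrix, cayleyMatrix, hn, Matrix.mul_smul, Matrix.smul_mul]
  congr 1
  fin_cases a <;> simp [spatial, rotationMatrix, Matrix.mulVec, dotProduct,
      Fin.sum_univ_four] at hz <;> simp only [rotationMatrix] <;> ext i j <;> fin_cases i <;>
      fin_cases j <;>
      simp [Matrix.mul_apply, Fin.sum_univ_four, hz] <;> grind

lemma spatial_apply (p : Fin 4 → ℝ) (i : Fin 3) : spatial p i = p i.succ := by
  fin_cases i <;> simp [spatial]

lemma coe_smul_apply {m : ℝ} (g : PoincareGroup) (k : momentumSpace m) (i : Fin 3) :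
    ((g • k : momentumSpace m) : Space) i = g.mat i.succ 0 * energy m k
      + (g.mat i.succ 1 * (k : Space) 0 + g.mat i.succ 2 * (k : Space) 1
        + g.mat i.succ 3 * (k : Space) 2) := by
  change spatial (g.mat.mulVec (fourMomentum m k)) i = _
  rw [spatial_apply]
  simp [Matrix.mulVec, dotProduct, Fin.sum_univ_four, fourMomentum]
  ring

lemma cross_apply (u v : Space) (i : Fin 3) :
    cross u v i = u (i + 1) * v (i + 2) - u (i + 2) * v (i + 1) := by
  fin_cases i <;> simp [cross, crossProduct]

lemma energy_smul {m : ℝ} (g : PoincareGroup) (k : momentumSpace m) :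
    energy m (g • k : momentumSpace m) = g.mat 0 0 * energy m k
      + (g.mat 0 1 * (k : Space) 0 + g.mat 0 2 * (k : Space) 1 + g.mat 0 3 * (k : Space) 2) := by
  have h := congrFun (fourMomentum_spatial g k).1 0
  change energy m (g • k : momentumSpace m) = _ at h
  rw [h]
  simp [Matrix.mulVec, dotProduct, Fin.sum_univ_four, fourMomentum]
  ring

/-- The spatial rotations, characterized by the first row of their matrix. -/
def PoincareGroup.IsRotation (g : PoincareGroup) : Prop :=
  g.mat 0 0 = 1 ∧ g.mat 0 1 = 0 ∧ g.mat 0 2 = 0 ∧ g.mat 0 3 = 0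

lemma isRotation_rotation (a : Fin 3) (t : ℝ) : (rotation a t).IsRotation := by
  fin_cases a <;> simp [PoincareGroup.IsRotation, rotation_mat, rotationMatrix]

/-- The first row says that the energy is preserved, and on the mass shell the energy determines
`|k|`. -/
lemma PoincareGroup.IsRotation.norm_smul {g : PoincareGroup} (hg : g.IsRotation) {m : ℝ}
    (k : momentumSpace m) : ‖((g • k : momentumSpace m) : Space)‖ = ‖(k : Space)‖ := by
  have h := energy_smul g k
  obtain ⟨h0, h1, h2, h3⟩ := hg
  rw [h0, h1, h2, h3] at h
  have h4 := energy_sq m (g • k : momentumSpace m)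
  have h5 := energy_sq m k
  have h6 : ‖((g • k : momentumSpace m) : Space)‖ ^ 2 = ‖(k : Space)‖ ^ 2 := by
    rw [h] at h4
    nlinarith
  exact (sq_eq_sq₀ (norm_nonneg _) (norm_nonneg _)).mp h6

lemma hasDerivAt_space {c : ℝ → Space} {v : Space} {t : ℝ}
    (h : ∀ i, HasDerivAt (fun s => c s i) (v i) t) : HasDerivAt c v t := by
  have := (hasDerivAt_pi (φ := fun s => WithLp.ofLp (c s)) (φ' := WithLp.ofLp v)).mpr h
  exact ((PiLp.continuousLinearEquiv 2 ℝ (fun _ : Fin 3 => ℝ)).symm.toContinuousLinearMap.hasFDerivAt).comp_hasDerivAt t this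

lemma hasDerivAt_rotation_inv_smul {m : ℝ} (a : Fin 3) (k : momentumSpace m) :
    HasDerivAt (fun t : ℝ => (((rotation a t)⁻¹ • k : momentumSpace m) : Space))
      (-cross (basisVec a) k) 0 := by
  refine hasDerivAt_space fun i => ?_
  have hc : HasDerivAt Real.cos 0 0 := by simpa using Real.hasDerivAt_cos 0
  have hs : HasDerivAt Real.sin 1 0 := by simpa using Real.hasDerivAt_sin 0
  -- The coordinate along the axis is constant; the others are `cos t` times `k i` plus `sin t`
  -- times `(-e_a × k) i`. One formula covers all cases.
  have h := ((hc.const_mul (if i = a then 0 else (k : Space) i)).const_add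
    (if i = a then (k : Space) i else 0)).add (hs.const_mul ((-cross (basisVec a) k) i))
  refine (h.congr_deriv (by simp)).congr_of_eventuallyEq (Filter.Eventually.of_forall fun t => ?_)
  simp only [coe_smul_apply, rotation_inv, rotation_mat, PiLp.neg_apply, cross_apply, Pi.add_apply]
  fin_cases a <;> fin_cases i <;> simp [rotationMatrix, basisVec] <;> ring

lemma hasDerivAt_boost_inv_smul {m : ℝ} (a : Fin 3) (k : momentumSpace m) :
    HasDerivAt (fun t : ℝ => (((boost a t)⁻¹ • k : momentumSpace m) : Space))
      (-(energy m k • basisVec a)) 0 := by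
  refine hasDerivAt_space fun i => ?_
  have hc : HasDerivAt Real.cosh 0 0 := by simpa using Real.hasDerivAt_cosh 0
  have hs : HasDerivAt Real.sinh 1 0 := by simpa using Real.hasDerivAt_sinh 0
  have h := ((hc.const_mul (if i = a then (k : Space) i else 0)).const_add
    (if i = a then 0 else (k : Space) i)).add
      (hs.const_mul ((-(energy m k • basisVec a) : Space) i))
  refine (h.congr_deriv (by simp)).congr_of_eventuallyEq (Filter.Eventually.of_forall fun t => ?_)
  simp only [coe_smul_apply, boost_inv, boost_mat, PiLp.neg_apply, PiLp.smul_apply, Pi.add_apply]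
  fin_cases a <;> fin_cases i <;> simp [boostMatrix, basisVec] <;> ring

end Families

/-! ### The operators `J` and `K` as first-order differential operators -/

section Operators

variable {m : ℝ} {F : Type*} [NormedAddCommGroup F] [NormedSpace ℂ F]
  {E : momentumSpace m → Type*} [∀ k, NormedAddCommGroup (E k)]
  [∀ k, InnerProductSpace ℂ (E k)] [TopologicalSpace (TotalSpace F E)] [FiberBundle F E]

lemma isOpen_ne_zero : IsOpen {k : momentumSpace m | (k : Space) ≠ 0} :=
  isOpen_compl_singleton.preimage continuous_subtype_val

lemma smoothSection_iff {ψ : ∀ k, E k} : SmoothSection F ψ ↔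
    ∀ k : momentumSpace m, (k : Space) ≠ 0 →
      ContMDiffAt 𝓘(ℝ, Space) (𝓘(ℝ, Space).prod 𝓘(ℝ, F)) ∞
        (fun k : momentumSpace m => TotalSpace.mk' F k (ψ k)) k :=
  ⟨fun h k hk => (h k hk).contMDiffAt (isOpen_ne_zero.mem_nhds hk),
    fun h k hk => (h k hk).contMDiffWithinAt⟩

lemma SmoothSection.add [VectorBundle ℝ F E] {ψ χ : ∀ k, E k} (hψ : SmoothSection F ψ)
    (hχ : SmoothSection F χ) : SmoothSection F fun k => ψ k + χ k :=
  ContMDiffOn.add_section hψ hχ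

lemma SmoothSection.sub [VectorBundle ℝ F E] {ψ χ : ∀ k, E k} (hψ : SmoothSection F ψ)
    (hχ : SmoothSection F χ) : SmoothSection F fun k => ψ k - χ k :=
  ContMDiffOn.sub_section hψ hχ

lemma SmoothSection.sum [VectorBundle ℝ F E] {ι : Type*} {s : Finset ι} {ψ : ι → ∀ k, E k}
    (hψ : ∀ i ∈ s, SmoothSection F (ψ i)) : SmoothSection F fun k => ∑ i ∈ s, ψ i k :=
  ContMDiffOn.sum_section hψ

lemma SmoothSection.smul [VectorBundle ℂ F E] {f : momentumSpace m → ℂ} {ψ : ∀ k, E k}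
    (hf : ∀ k : momentumSpace m, (k : Space) ≠ 0 → ContMDiffAt 𝓘(ℝ, Space) 𝓘(ℝ, ℂ) ∞ f k)
    (hψ : SmoothSection F ψ) : SmoothSection F fun k => f k • ψ k := by
  rw [smoothSection_iff] at hψ ⊢
  intro k hk
  have h := hψ k hk
  rw [contMDiffAt_section] at h ⊢
  refine (((ContinuousLinearMap.lsmul ℝ ℂ (E := F)).contDiff.contMDiff.contMDiffAt.comp k
    (hf k hk)).clm_apply h).congr_of_eventuallyEq ?_
  set e := trivializationAt F E k
  filter_upwards [e.open_baseSet.mem_nhds (FiberBundle.mem_baseSet_trivializationAt' k)] with q hq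
  exact (e.linear ℂ hq).2 (f q) (ψ q)

lemma SmoothSection.smul_space [VectorBundle ℂ F E] {f : Space → ℂ} {ψ : ∀ k, E k}
    (hf : ContDiffOn ℝ ∞ f {0}ᶜ) (hψ : SmoothSection F ψ) :
    SmoothSection F fun k => f k • ψ k := by
  refine SmoothSection.smul (f := fun k => f k) (fun k hk => ?_) hψ
  exact ContMDiffAt.comp k
    (hf.contDiffAt (isOpen_compl_singleton.mem_nhds hk)).contMDiffAt
    (contMDiff_subtype_val k)

lemma SmoothSection.smul_space_real [VectorBundle ℂ F E] {f : Space → ℝ} {ψ : ∀ k, E k}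
    (hf : ContDiffOn ℝ ∞ f {0}ᶜ) (hψ : SmoothSection F ψ) :
    SmoothSection F fun k => (f k : ℂ) • ψ k :=
  SmoothSection.smul_space (f := fun x => (f x : ℂ)) (Complex.ofRealCLM.contDiff.comp_contDiffOn hf)
    hψ

lemma SmoothSection.const_smul [VectorBundle ℂ F E] (c : ℂ) {ψ : ∀ k, E k}
    (hψ : SmoothSection F ψ) : SmoothSection F fun k => c • ψ k :=
  SmoothSection.smul_space (f := fun _ => c) contDiffOn_const hψ

namespace ParticleBundle

variable (B : ParticleBundle m F E)

lemma onSections_smul (g : PoincareGroup) (f : Space → ℂ) (ψ : ∀ k, E k) (k : momentumSpace m) :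
    B.onSections g (fun q => f q • ψ q) k =
      f ((g⁻¹ • k : momentumSpace m) : Space) • B.onSections g ψ k :=
  map_smul _ _ _

lemma onSections_add (g : PoincareGroup) (ψ χ : ∀ k, E k) (k : momentumSpace m) :
    B.onSections g (fun q => ψ q + χ q) k = B.onSections g ψ k + B.onSections g χ k :=
  map_add _ _ _

/-- Product rule for `Σ̃_g (f ψ) = (f ∘ g⁻¹) Σ̃_g ψ`, where `c` is the initial velocity of `g(t)⁻¹
k`. -/
lemma hasDerivAt_onSections_smul {g : ℝ → PoincareGroup} (h1 : g 0 = 1) {k : momentumSpace m}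
    {c : Space} (hc : HasDerivAt (fun t => (((g t)⁻¹ • k : momentumSpace m) : Space)) c 0)
    {f : Space → ℂ} (hf : DifferentiableAt ℝ f k) {ψ : ∀ k, E k} {v : E k}
    (hψ : HasDerivAt (fun t => B.onSections (g t) ψ k) v 0) :
    HasDerivAt (fun t => B.onSections (g t) (fun q => f q • ψ q) k)
      (fderiv ℝ f k c • ψ k + f k • v) 0 := by
  simp only [onSections_smul]
  have e : (((g 0)⁻¹ • k : momentumSpace m) : Space) = k := by rw [h1]; simp
  have hf' : HasFDerivAt f (fderiv ℝ f k) (((g 0)⁻¹ • k : momentumSpace m) : Space) := by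
    rw [e]; exact hf.hasFDerivAt
  have h := (hf'.comp_hasDerivAt 0 hc).smul hψ
  rw [add_comm]
  exact h.congr_deriv (by simp [h1, onSections_one])

lemma J_add (a : Fin 3) {ψ χ : ∀ k, E k} {k : momentumSpace m}
    (hψ : DifferentiableAt ℝ (fun t => B.onSections (rotation a t) ψ k) 0)
    (hχ : DifferentiableAt ℝ (fun t => B.onSections (rotation a t) χ k) 0) :
    B.J a (fun q => ψ q + χ q) k = B.J a ψ k + B.J a χ k := by
  simp only [J, onSections_add]
  rw [deriv_fun_add hψ hχ, smul_add]

lemma K_add (a : Fin 3) {ψ χ : ∀ k, E k} {k : momentumSpace m}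
    (hψ : DifferentiableAt ℝ (fun t => B.onSections (boost a t) ψ k) 0)
    (hχ : DifferentiableAt ℝ (fun t => B.onSections (boost a t) χ k) 0) :
    B.K a (fun q => ψ q + χ q) k = B.K a ψ k + B.K a χ k := by
  simp only [K, onSections_add]
  rw [deriv_fun_add hψ hχ, smul_add]

variable [VectorBundle ℝ F E]

lemma contDiffAt_onSections_curve {g : ℝ → PoincareGroup}
    (hg : SmoothFamily fun x : EuclideanSpace ℝ (Fin 1) => g (x 0)) {ψ : ∀ k, E k}
    (hψ : SmoothSection F ψ) (t : ℝ) (k : momentumSpace m)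
    (hk : (((g t)⁻¹ • k : momentumSpace m) : Space) ≠ 0) :
    ContDiffAt ℝ ∞ (fun s => B.onSections (g s) ψ k) t := by
  have h := B.contDiffAt_onSections hg hψ (t • EuclideanSpace.single 0 1) k (by simpa using hk)
  have h2 : ContDiffAt ℝ ∞ (fun s : ℝ => s • (EuclideanSpace.single 0 1 :
      EuclideanSpace ℝ (Fin 1))) t := by fun_prop
  simpa [Function.comp_def] using h.comp t h2

lemma smoothSection_deriv_onSections {g : ℝ → PoincareGroup}
    (hg : SmoothFamily fun x : EuclideanSpace ℝ (Fin 1) => g (x 0)) (h1 : g 0 = 1) {ψ : ∀ k, E k}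
    (hψ : SmoothSection F ψ) :
    SmoothSection F fun k => deriv (fun t => B.onSections (g t) ψ k) 0 := by
  rw [smoothSection_iff]
  intro k hk
  have h := B.contMDiffAt_fderiv_onSections hg hψ 0 (EuclideanSpace.single 0 1) k
    (by simpa [h1] using hk)
  refine h.congr_of_eventuallyEq ?_
  filter_upwards [isOpen_ne_zero.mem_nhds hk] with q hq
  have hd : HasFDerivAt (fun y : EuclideanSpace ℝ (Fin 1) => B.onSections (g (y 0)) ψ q) _ 0 :=
    ((B.contDiffAt_onSections hg hψ 0 q (by simpa [h1] using hq)).differentiableAt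
    (by simp)).hasFDerivAt
  have h2 : HasDerivAt (fun s : ℝ => s • (EuclideanSpace.single 0 1 :
      EuclideanSpace ℝ (Fin 1))) (EuclideanSpace.single 0 1) 0 := by
    simpa using (hasDerivAt_id (0 : ℝ)).smul_const (EuclideanSpace.single 0 1 :
      EuclideanSpace ℝ (Fin 1))
  have h3 := HasFDerivAt.comp_hasDerivAt_of_eq 0 hd h2 (by simp)
  rw [← h3.deriv]
  simp [Function.comp_def]

lemma differentiableAt_rotation (a : Fin 3) {ψ : ∀ k, E k} (hψ : SmoothSection F ψ)
    (k : momentumSpace m) (hk : (k : Space) ≠ 0) :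
    DifferentiableAt ℝ (fun t => B.onSections (rotation a t) ψ k) 0 :=
  (B.contDiffAt_onSections_curve (smoothFamily_rotation a (by fun_prop)) hψ 0 k
    (by simpa [rotation_zero] using hk)).differentiableAt (by simp)

lemma differentiableAt_boost (a : Fin 3) {ψ : ∀ k, E k} (hψ : SmoothSection F ψ)
    (k : momentumSpace m) (hk : (k : Space) ≠ 0) :
    DifferentiableAt ℝ (fun t => B.onSections (boost a t) ψ k) 0 :=
  (B.contDiffAt_onSections_curve (smoothFamily_boost a (by fun_prop)) hψ 0 k
    (by simpa [boost_zero] using hk)).differentiableAt (by simp)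

lemma smoothSection_J [VectorBundle ℂ F E] (a : Fin 3) {ψ : ∀ k, E k} (hψ : SmoothSection F ψ) :
    SmoothSection F (B.J a ψ) :=
  (B.smoothSection_deriv_onSections (smoothFamily_rotation a (by fun_prop)) (rotation_zero a)
    hψ).const_smul Complex.I

lemma smoothSection_K [VectorBundle ℂ F E] (a : Fin 3) {ψ : ∀ k, E k} (hψ : SmoothSection F ψ) :
    SmoothSection F (B.K a ψ) :=
  (B.smoothSection_deriv_onSections (smoothFamily_boost a (by fun_prop)) (boost_zero a)
    hψ).const_smul (-Complex.I)

/-- On coefficients `J_a` acts as `-i (k × ∇)_a`, and `K_a` in `K_smul` as `i ω ∂_a`. These two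
symbols make `D^R` a connection. -/
lemma J_smul (a : Fin 3) {f : Space → ℂ} {ψ : ∀ k, E k} (hψ : SmoothSection F ψ)
    {k : momentumSpace m} (hk : (k : Space) ≠ 0) (hf : DifferentiableAt ℝ f k) :
    B.J a (fun q => f q • ψ q) k =
      (-Complex.I * fderiv ℝ f k (cross (basisVec a) k)) • ψ k + f k • B.J a ψ k := by
  rw [J, (B.hasDerivAt_onSections_smul (rotation_zero a) (hasDerivAt_rotation_inv_smul a k) hf
    (B.differentiableAt_rotation a hψ k hk).hasDerivAt).deriv, J, map_neg]
  module

lemma K_smul (a : Fin 3) {f : Space → ℂ} {ψ : ∀ k, E k} (hψ : SmoothSection F ψ)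
    {k : momentumSpace m} (hk : (k : Space) ≠ 0) (hf : DifferentiableAt ℝ f k) :
    B.K a (fun q => f q • ψ q) k =
      (Complex.I * energy m k * fderiv ℝ f k (basisVec a)) • ψ k + f k • B.K a ψ k := by
  rw [K, (B.hasDerivAt_onSections_smul (boost_zero a) (hasDerivAt_boost_inv_smul a k) hf
    (B.differentiableAt_boost a hψ k hk).hasDerivAt).deriv, K, map_neg, map_smul, Complex.real_smul]
  module

/-- The Leibniz rule for `J` applied to a combination of three sections. -/
lemma J_sum_smul (a : Fin 3) {f : Fin 3 → Space → ℂ} {ψ : Fin 3 → ∀ k, E k}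
    (hψ : ∀ b, SmoothSection F (ψ b)) {k : momentumSpace m} (hk : (k : Space) ≠ 0)
    (hf : ∀ b, DifferentiableAt ℝ (f b) k) :
    B.J a (fun q => ∑ b, f b q • ψ b q) k =
      ∑ b, ((-Complex.I * fderiv ℝ (f b) k (cross (basisVec a) k)) • ψ b k
        + f b k • B.J a (ψ b) k) := by
  have hd : ∀ b, DifferentiableAt ℝ
      (fun t => B.onSections (rotation a t) (fun q => f b q • ψ b q) k) 0 := fun b =>
    (B.hasDerivAt_onSections_smul (rotation_zero a) (hasDerivAt_rotation_inv_smul a k) (hf b)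
      (B.differentiableAt_rotation a (hψ b) k hk).hasDerivAt).differentiableAt
  simp only [Fin.sum_univ_three]
  rw [B.J_add a (ψ := fun q => f 0 q • ψ 0 q + f 1 q • ψ 1 q) (χ := fun q => f 2 q • ψ 2 q)
    (by simp only [onSections_add]; exact (hd 0).add (hd 1)) (hd 2), B.J_add a (hd 0) (hd 1),
    B.J_smul a (hψ 0) hk (hf 0), B.J_smul a (hψ 1) hk (hf 1), B.J_smul a (hψ 2) hk (hf 2)]

/-- The action between two fibres is continuous and linear, so it commutes with the inner
derivative; the sign is `i²`. -/
lemma J_J_eq (a b : Fin 3) {ψ : ∀ k, E k} (hψ : SmoothSection F ψ) {k : momentumSpace m}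
    (hk : (k : Space) ≠ 0) :
    B.J a (B.J b ψ) k =
      -deriv (fun t => deriv (fun s => B.onSections (rotation a t * rotation b s) ψ k) 0) 0 := by
  have h : ∀ t, B.onSections (rotation a t) (B.J b ψ) k =
      Complex.I • deriv (fun s => B.onSections (rotation a t * rotation b s) ψ k) 0 := by
    intro t
    have hq : (((rotation a t)⁻¹ • k : momentumSpace m) : Space) ≠ 0 := by
      rw [rotation_inv, ← norm_ne_zero_iff, (isRotation_rotation a _).norm_smul]
      simpa using hk
    have h1 := (B.actL (rotation a t) _ k (smul_inv_smul _ k)).hasFDerivAt.comp_hasDerivAt 0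
      (B.differentiableAt_rotation b hψ _ hq).hasDerivAt
    simp only [onSections_mul]
    refine (map_smul _ _ _).trans ?_
    congr 1
    exact h1.deriv.symm
  simp only [J] at h ⊢
  simp only [h]
  rw [deriv_fun_const_smul_field, smul_smul, Complex.I_mul_I, neg_one_smul]

end ParticleBundle

/-! ### Second derivatives and the commutation relations of `J` -/

lemma hasDerivAt_deriv_line {W V : Type*} [NormedAddCommGroup W] [NormedSpace ℝ W]
    [NormedAddCommGroup V] [NormedSpace ℝ V] {f : W → V} (hf : ContDiffAt ℝ ∞ f 0) (v w : W) :
    HasDerivAt (fun t : ℝ => deriv (fun s : ℝ => f (s • v + t • w)) 0)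
      (fderiv ℝ (fderiv ℝ f) 0 w v) 0 := by
  have hev : ∀ᶠ x in nhds (0 : W), DifferentiableAt ℝ f x := by
    have := hf.of_le (m := 1) (by norm_cast)
    filter_upwards [this.eventually (by simp)] with x hx using hx.differentiableAt (by simp)
  have hd2 : DifferentiableAt ℝ (fderiv ℝ f) 0 :=
    (hf.fderiv_right (m := 1) (by norm_cast)).differentiableAt (by simp)
  have hw : HasDerivAt (fun t : ℝ => t • w) w 0 := by
    simpa using (hasDerivAt_id (0 : ℝ)).smul_const w
  have h1 : (fun t : ℝ => deriv (fun s : ℝ => f (s • v + t • w)) 0) =ᶠ[nhds 0]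
      fun t => fderiv ℝ f (t • w) v := by
    have : Filter.Tendsto (fun t : ℝ => t • w) (nhds 0) (nhds 0) := by
      simpa using hw.continuousAt.tendsto
    filter_upwards [this.eventually hev] with t ht
    have hv : HasDerivAt (fun s : ℝ => s • v + t • w) v 0 := by
      simpa using ((hasDerivAt_id (0 : ℝ)).smul_const v).add_const (t • w)
    exact (HasFDerivAt.comp_hasDerivAt_of_eq 0 ht.hasFDerivAt hv (by simp)).deriv
  have h2 := HasFDerivAt.comp_hasDerivAt_of_eq 0 hd2.hasFDerivAt hw (by simp)
  exact ((h2.clm_apply (hasDerivAt_const 0 v)).congr_deriv (by simp)).congr_of_eventuallyEq h1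

lemma toLp_pair_eq (s t : ℝ) : !₂[s, t] = s • (EuclideanSpace.single 0 1 :
    EuclideanSpace ℝ (Fin 2)) + t • (EuclideanSpace.single 1 1 : EuclideanSpace ℝ (Fin 2)) := by
  ext i; fin_cases i <;> simp

lemma deriv_deriv_comm {V : Type*} [NormedAddCommGroup V] [NormedSpace ℝ V]
    {f : EuclideanSpace ℝ (Fin 2) → V} (hf : ContDiffAt ℝ ∞ f 0) :
    deriv (fun t : ℝ => deriv (fun s : ℝ => f !₂[s, t]) 0) 0 =
      deriv (fun s : ℝ => deriv (fun t : ℝ => f !₂[s, t]) 0) 0 := by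
  simp only [toLp_pair_eq]
  have h1 := (hasDerivAt_deriv_line hf (EuclideanSpace.single 0 1) (EuclideanSpace.single 1 1)).deriv
  have h2 := (hasDerivAt_deriv_line hf (EuclideanSpace.single 1 1) (EuclideanSpace.single 0 1)).deriv
  rw [h1, hf.isSymmSndFDerivAt (by simp; norm_cast) _ _, ← h2]
  simp only [add_comm]

namespace ParticleBundle

variable (B : ParticleBundle m F E)
  [VectorBundle ℝ F E]

/-- The purpose is linearity of the generator in the axis `v`. The factor `1 / 2` is the slope of
`tan (s / 2)` at `0`. -/
lemma deriv_onSections_cayley (h : PoincareGroup) (v : Space) {ψ : ∀ k, E k}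
    (hψ : SmoothSection F ψ) {k : momentumSpace m}
    (hk : ((h⁻¹ • k : momentumSpace m) : Space) ≠ 0) :
    deriv (fun s : ℝ => B.onSections (cayley (Real.tan (s / 2) • v) * h) ψ k) 0 =
      fderiv ℝ (fun y => B.onSections (cayley y * h) ψ k) 0 ((1 / 2 : ℝ) • v) := by
  have hd : HasFDerivAt (fun y => B.onSections (cayley y * h) ψ k) _ 0 :=
    ((B.contDiffAt_onSections (smoothFamily_cayley.mul (smoothFamily_const h)) hψ 0 k
      (by simpa [cayley_zero] using hk)).differentiableAt (by simp)).hasFDerivAt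
  have ht : HasDerivAt (fun s : ℝ => Real.tan (s / 2)) (1 / 2) 0 := by
    have h1 : HasDerivAt Real.tan 1 ((0 : ℝ) / 2) := by
      simpa using Real.hasDerivAt_tan (x := (0 : ℝ) / 2) (by simp)
    simpa [Function.comp_def] using h1.comp (0 : ℝ) ((hasDerivAt_id (0 : ℝ)).div_const 2)
  exact (HasFDerivAt.comp_hasDerivAt_of_eq 0 hd (ht.smul_const v) (by simp)).deriv

lemma eventually_rotation_eq_cayley (a : Fin 3) :
    ∀ᶠ s : ℝ in nhds 0, rotation a s = cayley (Real.tan (s / 2) • basisVec a) := by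
  have hc : ContinuousAt (fun s : ℝ => Real.cos (s / 2)) 0 := by fun_prop
  filter_upwards [hc.eventually_ne (y := 0) (by simp)] with s hs using rotation_eq_cayley a hs

/-- Conjugating the infinitesimal rotation about the axis `a + 1` by a rotation about `a`. -/
lemma deriv_onSections_rotation_mul (a : Fin 3) (t : ℝ) {ψ : ∀ k, E k}
    (hψ : SmoothSection F ψ) {k : momentumSpace m} (hk : (k : Space) ≠ 0) :
    deriv (fun s => B.onSections (rotation a t * rotation (a + 1) s) ψ k) 0 =
      Real.cos t • deriv (fun s => B.onSections (rotation (a + 1) s * rotation a t) ψ k) 0 +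
      Real.sin t • deriv (fun s => B.onSections (rotation (a + 2) s * rotation a t) ψ k) 0 := by
  have hq : (((rotation a t)⁻¹ • k : momentumSpace m) : Space) ≠ 0 := by
    rw [rotation_inv, ← norm_ne_zero_iff, (isRotation_rotation a _).norm_smul]
    simpa using hk
  have h1 : ∀ b, deriv (fun s => B.onSections (rotation b s * rotation a t) ψ k) 0 =
      fderiv ℝ (fun y => B.onSections (cayley y * rotation a t) ψ k) 0
        ((1 / 2 : ℝ) • basisVec b) := by
    intro b
    rw [← B.deriv_onSections_cayley _ _ hψ hq]
    refine Filter.EventuallyEq.deriv_eq ?_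
    filter_upwards [eventually_rotation_eq_cayley b] with s hs
    rw [hs]
  have hv : ∀ c : ℝ, spatial ((rotationMatrix a t).mulVec
      ![0, (c • basisVec (a + 1)) 0, (c • basisVec (a + 1)) 1, (c • basisVec (a + 1)) 2]) =
        c • (Real.cos t • basisVec (a + 1) + Real.sin t • basisVec (a + 2)) := by
    intro c
    ext i
    rw [spatial_apply]
    fin_cases a <;> fin_cases i <;>
      simp [rotationMatrix, basisVec, Matrix.mulVec, dotProduct, Fin.sum_univ_four] <;> ring
  have h2 : deriv (fun s => B.onSections (rotation a t * rotation (a + 1) s) ψ k) 0 =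
      fderiv ℝ (fun y => B.onSections (cayley y * rotation a t) ψ k) 0
        ((1 / 2 : ℝ) • (Real.cos t • basisVec (a + 1) + Real.sin t • basisVec (a + 2))) := by
    rw [← B.deriv_onSections_cayley _ _ hψ hq]
    refine Filter.EventuallyEq.deriv_eq ?_
    filter_upwards [eventually_rotation_eq_cayley (a + 1)] with s hs
    rw [hs, rotation_mul_cayley, hv]
  simp only [h2, h1, map_smul, map_add]
  module

/-- The angular momentum relations of `J`. -/
lemma J_comm (a : Fin 3) {ψ : ∀ k, E k} (hψ : SmoothSection F ψ) {k : momentumSpace m}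
    (hk : (k : Space) ≠ 0) :
    B.J a (B.J (a + 1) ψ) k - B.J (a + 1) (B.J a ψ) k = Complex.I • B.J (a + 2) ψ k := by
  have hsm : ∀ b, ContDiffAt ℝ ∞ (fun x : EuclideanSpace ℝ (Fin 2) =>
      B.onSections (rotation b (x 0) * rotation a (x 1)) ψ k) 0 := fun b =>
    B.contDiffAt_onSections ((smoothFamily_rotation b (by fun_prop)).mul
      (smoothFamily_rotation a (by fun_prop))) hψ 0 k (by simpa [rotation_zero] using hk)
  have hdiff : ∀ b, DifferentiableAt ℝ
      (fun t => deriv (fun s => B.onSections (rotation b s * rotation a t) ψ k) 0) 0 := by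
    intro b
    have h := (hasDerivAt_deriv_line (hsm b) (EuclideanSpace.single 0 1)
      (EuclideanSpace.single 1 1)).differentiableAt
    simpa using h
  rw [B.J_J_eq a _ hψ hk, B.J_J_eq (a + 1) a hψ hk]
  -- Symmetry of second derivatives puts the `R_a` parameter outermost in `J_{a+1} J_a` too, with
  -- the product order `R_{a+1}(s) R_a(t)`.
  have hs := deriv_deriv_comm (hsm (a + 1))
  simp only [Matrix.cons_val] at hs
  rw [← hs]
  simp only [B.deriv_onSections_rotation_mul a _ hψ hk]
  -- At `t = 0` the cosine term reproduces the mixed derivative of `J_{a+1} J_a`, which cancels; the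
  -- derivative of the sine leaves the generator about `a + 2`.
  have h1 := ((Real.hasDerivAt_cos 0).smul (hdiff (a + 1)).hasDerivAt).add
    ((Real.hasDerivAt_sin 0).smul (hdiff (a + 2)).hasDerivAt)
  have h2 : deriv (fun t => Real.cos t •
      deriv (fun s => B.onSections (rotation (a + 1) s * rotation a t) ψ k) 0 +
      Real.sin t • deriv (fun s => B.onSections (rotation (a + 2) s * rotation a t) ψ k) 0) 0 = _ :=
    h1.deriv
  rw [h2]
  simp only [Real.cos_zero, Real.sin_zero, neg_zero, zero_smul, one_smul, add_zero, zero_add,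
    rotation_zero, mul_one, J, smul_smul, Complex.I_mul_I]
  module

end ParticleBundle

end Operators

/-! ### The rotation connection -/

section RotationConnection

lemma inner_space (u v : Space) : inner ℝ u v = u 0 * v 0 + u 1 * v 1 + u 2 * v 2 := by
  simp [PiLp.inner_apply, Fin.sum_univ_three]
  ring

lemma space_eq_sum (v : Space) :
    v = v 0 • basisVec 0 + v 1 • basisVec 1 + v 2 • basisVec 2 := by
  ext i; fin_cases i <;> simp [basisVec]

lemma map_space (L : Space →L[ℝ] ℂ) (v : Space) :
    L v = v 0 * L (basisVec 0) + v 1 * L (basisVec 1) + v 2 * L (basisVec 2) := by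
  conv_lhs => rw [space_eq_sum v]
  simp

lemma norm_sq_pos {k : Space} (hk : k ≠ 0) : 0 < k 0 ^ 2 + k 1 ^ 2 + k 2 ^ 2 := by
  rw [← space_norm_sq]
  have := norm_pos_iff.mpr hk
  positivity

lemma inv_norm_sq_mul {k : Space} (hk : k ≠ 0) :
    ‖k‖⁻¹ * ‖k‖⁻¹ * (k 0 ^ 2 + k 1 ^ 2 + k 2 ^ 2) = 1 := by
  rw [← space_norm_sq]
  have := norm_ne_zero_iff.mpr hk
  field_simp

lemma contDiffOn_apply {X : Space → Space} (hX : SmoothField X) (i : Fin 3) :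
    ContDiffOn ℝ ∞ (fun q => X q i) {0}ᶜ :=
  (EuclideanSpace.proj i : Space →L[ℝ] ℝ).contDiff.comp_contDiffOn hX

lemma contDiffOn_inv_norm : ContDiffOn ℝ ∞ (fun q : Space => ‖q‖⁻¹) {0}ᶜ := by
  intro q hq
  exact ((contDiffAt_norm ℝ hq).inv (norm_ne_zero_iff.mpr hq)).contDiffWithinAt

lemma smoothField_eRadial : SmoothField eRadial :=
  contDiffOn_inv_norm.smul contDiffOn_id

lemma contDiffOn_energy (m : ℝ) : ContDiffOn ℝ ∞ (fun q : Space => energy m q) {0}ᶜ := by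
  refine ContDiffOn.sqrt ?_ ?_
  · exact (contDiff_const.add (contDiff_norm_sq ℝ)).contDiffOn
  · intro q hq
    have := norm_pos_iff.mpr hq
    positivity

lemma energy_ne_zero (m : ℝ) {q : Space} (hq : q ≠ 0) : energy m q ≠ 0 := by
  have := norm_pos_iff.mpr hq
  exact (Real.sqrt_pos.mpr (by positivity)).ne'

lemma contDiffOn_inner {X Y : Space → Space} (hX : SmoothField X) (hY : SmoothField Y) :
    ContDiffOn ℝ ∞ (fun q => inner ℝ (X q) (Y q)) {0}ᶜ := by
  simp only [inner_space]
  exact (((contDiffOn_apply hX 0).mul (contDiffOn_apply hY 0)).add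
    ((contDiffOn_apply hX 1).mul (contDiffOn_apply hY 1))).add
    ((contDiffOn_apply hX 2).mul (contDiffOn_apply hY 2))

lemma contDiffOn_cross_apply {X Y : Space → Space} (hX : SmoothField X) (hY : SmoothField Y)
    (i : Fin 3) : ContDiffOn ℝ ∞ (fun q => cross (X q) (Y q) i) {0}ᶜ := by
  simp only [cross_apply]
  exact ((contDiffOn_apply hX _).mul (contDiffOn_apply hY _)).sub
    ((contDiffOn_apply hX _).mul (contDiffOn_apply hY _))

variable {m : ℝ} {F : Type*} [NormedAddCommGroup F] [NormedSpace ℂ F]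
  {E : momentumSpace m → Type*} [∀ k, NormedAddCommGroup (E k)]
  [∀ k, InnerProductSpace ℂ (E k)] [TopologicalSpace (TotalSpace F E)] [FiberBundle F E]

lemma smoothSection_dotOp [VectorBundle ℝ F E] [VectorBundle ℂ F E] {X : Space → Space}
    (hX : ∀ a, ContDiffOn ℝ ∞ (fun q => X q a) {0}ᶜ) {A : Fin 3 → (∀ k, E k) → ∀ k, E k}
    {ψ : ∀ k, E k} (hA : ∀ a, SmoothSection F (A a ψ)) : SmoothSection F (dotOp X A ψ) :=
  SmoothSection.sum (ψ := fun a k => (X k a : ℂ) • A a ψ k) fun a _ =>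
    SmoothSection.smul_space_real (hX a) (hA a)

namespace ParticleBundle

variable (B : ParticleBundle m F E)

lemma J_const_smul (a : Fin 3) (c : ℂ) (ψ : ∀ k, E k) (k : momentumSpace m) :
    B.J a (fun q => c • ψ q) k = c • B.J a ψ k := by
  simp only [J, B.onSections_smul _ (fun _ => c)]
  rw [deriv_fun_const_smul_field, smul_comm]

variable [VectorBundle ℝ F E]

lemma smoothSection_rotationConnection [VectorBundle ℂ F E] {X : Space → Space}
    (hX : SmoothField X) {ψ : ∀ k, E k} (hψ : SmoothSection F ψ) :
    SmoothSection F (B.rotationConnection X ψ) := by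
  have hid : SmoothField fun q => q := contDiffOn_id
  have hE := contDiffOn_energy m
  have h1 : SmoothSection F (dotOp (fun q => cross (X q) (eRadial q)) B.J ψ) :=
    smoothSection_dotOp (contDiffOn_cross_apply hX smoothField_eRadial)
      fun a => B.smoothSection_J a hψ
  have h2 : SmoothSection F (dotOp eRadial B.K ψ) :=
    smoothSection_dotOp (contDiffOn_apply smoothField_eRadial) fun a => B.smoothSection_K a hψ
  have h3 := SmoothSection.smul_space_real contDiffOn_inv_norm h1
  have h4 := SmoothSection.smul_space_real
    ((hE.inv fun q hq => energy_ne_zero m hq).mul (contDiffOn_inner hX smoothField_eRadial)) h2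
  have h5 : ContDiffOn ℝ ∞
      (fun q => Complex.I * ((inner ℝ (X q) q / (2 * energy m q ^ 2) : ℝ) : ℂ)) {0}ᶜ := by
    refine contDiffOn_const.mul (Complex.ofRealCLM.contDiff.comp_contDiffOn ?_)
    refine (contDiffOn_inner hX hid).div (contDiffOn_const.mul (hE.pow 2)) fun q hq => ?_
    have := energy_ne_zero m hq
    positivity
  exact ((h3.add h4).sub (SmoothSection.smul_space h5 hψ)).const_smul (-Complex.I)

/-- `D^R` is a connection on the restriction of `E` to `ℝ³ \ {0}`. -/
theorem isConnection_rotationConnection [VectorBundle ℂ F E] :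
    IsConnection F B.rotationConnection where
  smooth X ψ hX hψ := B.smoothSection_rotationConnection hX hψ
  add_field X Y ψ _ _ _ k _ := by
    simp only [rotationConnection, dotOp, Fin.sum_univ_three, cross_apply, inner_space,
      Pi.add_apply, PiLp.add_apply]
    push_cast
    module
  smul_field f X ψ _ _ _ k _ := by
    simp only [rotationConnection, dotOp, Fin.sum_univ_three, cross_apply, inner_space,
      PiLp.smul_apply, smul_eq_mul]
    push_cast
    module
  add_section X ψ χ _ hψ hχ k hk := by
    have hJ := fun a => B.J_add a (B.differentiableAt_rotation a hψ k hk)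
      (B.differentiableAt_rotation a hχ k hk)
    have hK := fun a => B.K_add a (B.differentiableAt_boost a hψ k hk)
      (B.differentiableAt_boost a hχ k hk)
    simp only [rotationConnection, dotOp, Fin.sum_univ_three, hJ, hK]
    module
  leibniz f X ψ hf hX hψ k hk := by
    have hfd : DifferentiableAt ℝ f k :=
      (hf.contDiffAt (isOpen_compl_singleton.mem_nhds hk)).differentiableAt (by simp)
    have hJ := fun a => B.J_smul a hψ hk hfd
    have hK := fun a => B.K_smul a hψ hk hfd
    -- In the coefficient of `ψ k` the `J` term gives the derivative of `f` along the part of `X`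
    -- orthogonal to `k`, and the `K` term gives the radial part, `H⁻¹` cancelling the `ω` from
    -- `K_smul`. Recombining them uses `hw` and `|k̂| = 1`, which is `hρ`.
    have hI := Complex.I_mul_I
    have hw : ((energy m k)⁻¹ : ℂ) * (energy m k : ℂ) = 1 :=
      inv_mul_cancel₀ (Complex.ofReal_ne_zero.mpr (energy_ne_zero m hk))
    have hρ : ((‖(k : Space)‖⁻¹ * ‖(k : Space)‖⁻¹ * ((k : Space) 0 ^ 2 + (k : Space) 1 ^ 2 +
      (k : Space) 2 ^ 2) : ℝ) : ℂ) = ((1 : ℝ) : ℂ) := by rw [inv_norm_sq_mul hk]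
    rw [map_space (fderiv ℝ f k) (X k)]
    simp only [rotationConnection, dotOp, Fin.sum_univ_three, hJ, hK, inner_space]
    rw [map_space (fderiv ℝ f k) (cross (basisVec 0) k),
      map_space (fderiv ℝ f k) (cross (basisVec 1) k),
      map_space (fderiv ℝ f k) (cross (basisVec 2) k)]
    simp only [cross_apply, eRadial, PiLp.smul_apply, smul_eq_mul]
    simp [basisVec] at hρ ⊢
    generalize (fderiv ℝ f k) (EuclideanSpace.single 0 1) = d0
    generalize (fderiv ℝ f k) (EuclideanSpace.single 1 1) = d1
    generalize (fderiv ℝ f k) (EuclideanSpace.single 2 1) = d2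
    generalize ((X k 0 : ℝ) : ℂ) = x0
    generalize ((X k 1 : ℝ) : ℂ) = x1
    generalize ((X k 2 : ℝ) : ℂ) = x2
    generalize (((k : Space) 0 : ℝ) : ℂ) = k0 at *
    generalize (((k : Space) 1 : ℝ) : ℂ) = k1 at *
    generalize (((k : Space) 2 : ℝ) : ℂ) = k2 at *
    generalize ((‖(k : Space)‖ : ℝ) : ℂ)⁻¹ = ρ at *
    generalize ((energy m k : ℝ) : ℂ)⁻¹ = w' at *
    generalize ((energy m k : ℝ) : ℂ) = w at *
    match_scalars <;> first
      | ring1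
      | linear_combination (ρ * ρ * ((x0 * k0 + x1 * k1 + x2 * k2) * (k0 * d0 + k1 * d1 + k2 * d2)
            - (x0 * d0 + x1 * d1 + x2 * d2) * (k0 ^ 2 + k1 ^ 2 + k2 ^ 2)) - w' * w * (ρ * ρ) *
            ((x0 * k0 + x1 * k1 + x2 * k2) * (k0 * d0 + k1 * d1 + k2 * d2))) * hI
          + ρ * ρ * ((x0 * k0 + x1 * k1 + x2 * k2) * (k0 * d0 + k1 * d1 + k2 * d2)) * hw
          + (x0 * d0 + x1 * d1 + x2 * d2) * hρ

end ParticleBundle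

/-! ### Curvature along the spheres -/

/-- The coefficients of `D^R_X = i Σ vₐ Jₐ`, `v = k × X / |k|²`, for `X` tangent to the spheres. -/
noncomputable def tangentCoeff (X : Space → Space) (a : Fin 3) (q : Space) : ℝ :=
  (q 0 ^ 2 + q 1 ^ 2 + q 2 ^ 2)⁻¹ * cross q (X q) a

/-- Along a tangent direction `|k|` is constant. -/
lemma hasDerivAt_tangentCoeff {Y : Space → Space} {k v : Space} (hk : k ≠ 0)
    (hv : v 0 * k 0 + v 1 * k 1 + v 2 * k 2 = 0) (hY : DifferentiableAt ℝ Y k) (b : Fin 3) :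
    DifferentiableAt ℝ (tangentCoeff Y b) k ∧
    fderiv ℝ (tangentCoeff Y b) k v = (k 0 ^ 2 + k 1 ^ 2 + k 2 ^ 2)⁻¹ *
      (cross v (Y k) b + cross k (fderiv ℝ Y k v) b) := by
  have hn := norm_sq_pos hk
  have hc : ∀ i : Fin 3, HasFDerivAt (fun q : Space => q i)
      (EuclideanSpace.proj i : Space →L[ℝ] ℝ) k := fun i =>
    (EuclideanSpace.proj i : Space →L[ℝ] ℝ).hasFDerivAt
  have hYc : ∀ i : Fin 3, HasFDerivAt (fun q : Space => Y q i)
      ((EuclideanSpace.proj i : Space →L[ℝ] ℝ).comp (fderiv ℝ Y k)) k := fun i =>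
    (EuclideanSpace.proj i : Space →L[ℝ] ℝ).hasFDerivAt.comp k hY.hasFDerivAt
  have h0 := (((hc 0).pow 2).add ((hc 1).pow 2)).add ((hc 2).pow 2)
  have h1 := hasDerivAt_inv hn.ne'
  have h := (HasDerivAt.comp_hasFDerivAt k h1 h0).mul (((hc (b + 1)).mul (hYc (b + 2))).sub ((hc (b + 2)).mul (hYc (b + 1))))
  have h2 := h.congr_of_eventuallyEq (f₁ := tangentCoeff Y b)
    (Filter.Eventually.of_forall fun q => by simp only [tangentCoeff, cross_apply]; rfl)
  refine ⟨h2.differentiableAt, ?_⟩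
  rw [h2.fderiv]
  have h3 : k 0 * v 0 + k 1 * v 1 + k 2 * v 2 = 0 := by linarith
  simp [cross_apply]
  linear_combination (-2 * ((k 0 ^ 2 + k 1 ^ 2 + k 2 ^ 2) ^ 2)⁻¹ *
    (k (b + 1) * Y k (b + 2) - k (b + 2) * Y k (b + 1))) * h3

namespace ParticleBundle

variable (B : ParticleBundle m F E)

/-- The boost and scalar terms carry the factor `X · k`, so only `J`, which is closed under
commutators, survives. -/
lemma rotationConnection_of_tangent {X : Space → Space} {k : momentumSpace m}
    (hX : inner ℝ (X k) (k : Space) = 0) (ψ : ∀ k, E k) :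
    B.rotationConnection X ψ k = ∑ a, (Complex.I * (tangentCoeff X a k : ℂ)) • B.J a ψ k := by
  have h1 : inner ℝ (X k) (eRadial (k : Space)) = 0 := by
    rw [eRadial, inner_smul_right, hX, mul_zero]
  have h2 : ((k : Space) 0 ^ 2 + (k : Space) 1 ^ 2 + (k : Space) 2 ^ 2)⁻¹ =
      ‖(k : Space)‖⁻¹ * ‖(k : Space)‖⁻¹ := by
    rw [← space_norm_sq, sq, mul_inv]
  simp only [rotationConnection, hX, h1, tangentCoeff, h2, dotOp, Fin.sum_univ_three, cross_apply]
  simp only [eRadial, PiLp.smul_apply, smul_eq_mul]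
  push_cast
  module

variable [VectorBundle ℝ F E] [VectorBundle ℂ F E]

/-- `D_X D_Y` for vector fields tangent to the spheres. -/
lemma rotationConnection_rotationConnection_of_tangent {X Y : Space → Space}
    (hY : ∀ q, inner ℝ (Y q) q = 0) {ψ : ∀ k, E k} (hψ : SmoothSection F ψ)
    {k : momentumSpace m} (hk : (k : Space) ≠ 0) (hX : inner ℝ (X k) (k : Space) = 0)
    (hYd : DifferentiableAt ℝ Y k) :
    B.rotationConnection X (B.rotationConnection Y ψ) k =
      ∑ b, (Complex.I * (fderiv ℝ (tangentCoeff Y b) k (X k) : ℂ)) • B.J b ψ k -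
      ∑ a, ∑ b, ((tangentCoeff X a k : ℂ) * (tangentCoeff Y b k : ℂ)) • B.J a (B.J b ψ) k := by
  have hX' : X k 0 * (k : Space) 0 + X k 1 * (k : Space) 1 + X k 2 * (k : Space) 2 = 0 := by
    rw [← inner_space]; exact hX
  have e : B.rotationConnection Y ψ =
      fun q : momentumSpace m => ∑ b, (Complex.I * (tangentCoeff Y b q : ℂ)) • B.J b ψ q :=
    funext fun q => B.rotationConnection_of_tangent (hY q) ψ
  have hd : ∀ b, HasFDerivAt (fun q : Space => Complex.I * (tangentCoeff Y b q : ℂ))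
      (Complex.I • Complex.ofRealCLM.comp (fderiv ℝ (tangentCoeff Y b) k)) k := fun b =>
    (Complex.ofRealCLM.hasFDerivAt.comp (k : Space)
      (hasDerivAt_tangentCoeff hk hX' hYd b).1.hasFDerivAt).const_mul Complex.I
  have hJ := fun a => B.J_sum_smul a (ψ := fun b => B.J b ψ)
    (f := fun b q => Complex.I * (tangentCoeff Y b q : ℂ))
    (fun b => B.smoothSection_J b hψ) hk fun b => (hd b).differentiableAt
  -- Since `X ⟂ k`, one has `X = v_X × k`; hence the derivatives along `e_a × k` produced by the
  -- `J_a`, weighted by `v_X`, add up to the derivative along `X`.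
  have hfd : ∀ b, fderiv ℝ (tangentCoeff Y b) k (X k) =
      ∑ a, tangentCoeff X a k * fderiv ℝ (tangentCoeff Y b) k (cross (basisVec a) k) := by
    intro b
    have hv : X k = ∑ a, tangentCoeff X a k • cross (basisVec a) (k : Space) := by
      have hn := (norm_sq_pos hk).ne'
      ext i
      have hi : X k i = ((k : Space) 0 ^ 2 + (k : Space) 1 ^ 2 + (k : Space) 2 ^ 2)⁻¹ *
          (((k : Space) 0 ^ 2 + (k : Space) 1 ^ 2 + (k : Space) 2 ^ 2) * X k i) := by
        field_simp
      rw [hi]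
      simp only [Fin.sum_univ_three, PiLp.add_apply, PiLp.smul_apply, smul_eq_mul, tangentCoeff,
        cross_apply]
      generalize ((k : Space) 0 ^ 2 + (k : Space) 1 ^ 2 + (k : Space) 2 ^ 2)⁻¹ = n
      fin_cases i <;> simp [basisVec] <;> first
        | linear_combination (n * (k : Space) 0) * hX'
        | linear_combination (n * (k : Space) 1) * hX'
        | linear_combination (n * (k : Space) 2) * hX'
    conv_lhs => rw [hv]
    simp
  rw [e, B.rotationConnection_of_tangent hX]
  have hterm : ∀ (u v d : ℂ) (φ χ : E k), (Complex.I * u) •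
      ((-Complex.I * (Complex.I * d)) • φ + (Complex.I * v) • χ) =
        (Complex.I * (u * d)) • φ - (u * v) • χ := by
    intro u v d φ χ
    have hI := Complex.I_mul_I
    match_scalars
    · linear_combination (-Complex.I * u * d) * hI
    · linear_combination (u * v) * hI
  simp only [hJ]
  simp only [(hd _).fderiv, hfd, smul_apply, ContinuousLinearMap.comp_apply,
    Complex.ofRealCLM_apply, smul_eq_mul, Finset.smul_sum, hterm, Finset.sum_sub_distrib]
  congr 1
  rw [Finset.sum_comm]
  refine Finset.sum_congr rfl fun b _ => ?_
  push_cast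
  rw [Finset.mul_sum, Finset.sum_smul]

/-- Differentiating `Z · q = 0` along `v` gives `Z · v + (∂_v Z) · k = 0`. For `X` along `Y` and `Y`
along `X` the terms `X · Y` cancel in the difference. -/
lemma inner_lieBracket {X Y : Space → Space} (hX : ∀ q, inner ℝ (X q) q = 0)
    (hY : ∀ q, inner ℝ (Y q) q = 0) {k : Space} (hXd : DifferentiableAt ℝ X k)
    (hYd : DifferentiableAt ℝ Y k) : inner ℝ (VectorField.lieBracket ℝ X Y k) k = 0 := by
  have aux : ∀ {Z : Space → Space}, (∀ q, inner ℝ (Z q) q = 0) → DifferentiableAt ℝ Z k →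
      ∀ v, inner ℝ (Z k) v + inner ℝ (fderiv ℝ Z k v) k = 0 := by
    intro Z hZ hZd v
    have h := hZd.hasFDerivAt.inner ℝ (hasFDerivAt_id k)
    have h2 : (fun q => inner ℝ (Z q) (id q)) = fun _ => (0 : ℝ) := funext fun q => hZ q
    rw [h2] at h
    simpa using (congrArg (fun L => L v) (h.unique (hasFDerivAt_const 0 k)))
  have h1 := aux hX hXd (Y k)
  have h2 := aux hY hYd (X k)
  rw [VectorField.lieBracket, inner_sub_left]
  rw [real_inner_comm] at h1
  linarith

/-- The `S²`-curvature of the rotation connection. -/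
theorem curvature_rotationConnection {X Y : Space → Space} (hX : ∀ q, inner ℝ (X q) q = 0)
    (hY : ∀ q, inner ℝ (Y q) q = 0) {ψ : ∀ k, E k} (hψ : SmoothSection F ψ)
    {k : momentumSpace m} (hk : (k : Space) ≠ 0) (hXd : DifferentiableAt ℝ X k)
    (hYd : DifferentiableAt ℝ Y k) :
    curvature B.rotationConnection X Y ψ k =
      (Complex.I / ((‖(k : Space)‖ ^ 2 : ℝ) : ℂ)) •
        dotOp (fun q => cross (X q) (Y q)) B.J ψ k := by
  rw [curvature, B.rotationConnection_rotationConnection_of_tangent hY hψ hk (hX k) hYd,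
    B.rotationConnection_rotationConnection_of_tangent hX hψ hk (hY k) hXd,
    B.rotationConnection_of_tangent (inner_lieBracket hX hY hXd hYd)]
  have h01 := sub_eq_iff_eq_add.mp (B.J_comm 0 hψ hk)
  have h12 := sub_eq_iff_eq_add.mp (B.J_comm 1 hψ hk)
  have h20 := sub_eq_iff_eq_add.mp (B.J_comm 2 hψ hk)
  simp only [Fin.reduceAdd] at h01 h12 h20
  have hX' : X k 0 * (k : Space) 0 + X k 1 * (k : Space) 1 + X k 2 * (k : Space) 2 = 0 := by
    rw [← inner_space]; exact hX k
  have hY' : Y k 0 * (k : Space) 0 + Y k 1 * (k : Space) 1 + Y k 2 * (k : Space) 2 = 0 := by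
    rw [← inner_space]; exact hY k
  have hn := (norm_sq_pos hk).ne'
  -- The coefficient of `i J_b`. With `n = |k|⁻²`, the derivatives give `2 n X × Y + v_[X,Y]`, and
  -- `v_X × v_Y = n X × Y` because `X × Y` is parallel to `k`; one copy of `n X × Y` remains.
  have key : ∀ b, fderiv ℝ (tangentCoeff Y b) k (X k) - fderiv ℝ (tangentCoeff X b) k (Y k)
      - (tangentCoeff X (b + 1) k * tangentCoeff Y (b + 2) k
        - tangentCoeff X (b + 2) k * tangentCoeff Y (b + 1) k)
      - tangentCoeff (VectorField.lieBracket ℝ X Y) b k =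
        ((k : Space) 0 ^ 2 + (k : Space) 1 ^ 2 + (k : Space) 2 ^ 2)⁻¹ * cross (X k) (Y k) b := by
    intro b
    rw [(hasDerivAt_tangentCoeff hk hX' hYd b).2, (hasDerivAt_tangentCoeff hk hY' hXd b).2]
    simp only [tangentCoeff, VectorField.lieBracket, cross_apply, PiLp.sub_apply]
    generalize fderiv ℝ X k (Y k) = dX
    generalize fderiv ℝ Y k (X k) = dY
    have hni : ((k : Space) 0 ^ 2 + (k : Space) 1 ^ 2 + (k : Space) 2 ^ 2)⁻¹ *
      ((k : Space) 0 ^ 2 + (k : Space) 1 ^ 2 + (k : Space) 2 ^ 2) = 1 := inv_mul_cancel₀ hn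
    generalize ((k : Space) 0 ^ 2 + (k : Space) 1 ^ 2 + (k : Space) 2 ^ 2)⁻¹ = n at *
    fin_cases b <;> simp
    · linear_combination (n ^ 2 * ((k : Space) 1 * Y k 2 - (k : Space) 2 * Y k 1)) * hX'
        - (n ^ 2 * ((k : Space) 1 * X k 2 - (k : Space) 2 * X k 1)) * hY'
        - (n * (X k 1 * Y k 2 - X k 2 * Y k 1)) * hni
    · linear_combination (n ^ 2 * ((k : Space) 2 * Y k 0 - (k : Space) 0 * Y k 2)) * hX'
        - (n ^ 2 * ((k : Space) 2 * X k 0 - (k : Space) 0 * X k 2)) * hY'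
        - (n * (X k 2 * Y k 0 - X k 0 * Y k 2)) * hni
    · linear_combination (n ^ 2 * ((k : Space) 0 * Y k 1 - (k : Space) 1 * Y k 0)) * hX'
        - (n ^ 2 * ((k : Space) 0 * X k 1 - (k : Space) 1 * X k 0)) * hY'
        - (n * (X k 0 * Y k 1 - X k 1 * Y k 0)) * hni
  simp only [sub_eq_iff_eq_add] at key
  rw [space_norm_sq]
  simp only [Fin.sum_univ_three, dotOp, h01, h12, h20, key, Fin.reduceAdd, div_eq_mul_inv,
    ← Complex.ofReal_inv]
  push_cast
  module

end ParticleBundle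

end RotationConnection

/-! ### The spherical frame and the fields `e_a × k` -/

section SphericalFields

/-- The distance of `k` from the polar axis. -/
noncomputable def axisDist (q : Space) : ℝ := Real.sqrt (q 0 ^ 2 + q 1 ^ 2)

lemma norm_eq_axisDist (q : Space) : ‖(⟨q 0, q 1⟩ : ℂ)‖ = axisDist q := by
  rw [axisDist, Complex.norm_def, Complex.normSq_mk, sq, sq]

lemma axisDist_mul_cos_azimuth (q : Space) : axisDist q * Real.cos (azimuth q) = q 0 := by
  rw [← norm_eq_axisDist, azimuth, Complex.norm_mul_cos_arg]

lemma axisDist_mul_sin_azimuth (q : Space) : axisDist q * Real.sin (azimuth q) = q 1 := by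
  rw [← norm_eq_axisDist, azimuth, Complex.norm_mul_sin_arg]

lemma axisDist_sq (q : Space) : axisDist q ^ 2 = q 0 ^ 2 + q 1 ^ 2 :=
  Real.sq_sqrt (by positivity)

lemma norm_mul_cos_polarAngle (q : Space) : ‖q‖ * Real.cos (polarAngle q) = q 2 := by
  have h := space_norm_sq q
  have h2 : |q 2| ≤ ‖q‖ := abs_le_of_sq_le_sq (by nlinarith [sq_nonneg (q 0), sq_nonneg (q 1)])
    (norm_nonneg q)
  rcases (norm_nonneg q).eq_or_lt with h0 | h0
  · rw [← h0] at h2 ⊢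
    rw [abs_nonpos_iff.mp h2, zero_mul]
  · have h3 := abs_le.mp h2
    rw [polarAngle, Real.cos_arccos (by rw [le_div_iff₀ h0]; linarith)
      (by rw [div_le_one h0]; linarith)]
    field_simp

lemma norm_mul_sin_polarAngle (q : Space) : ‖q‖ * Real.sin (polarAngle q) = axisDist q := by
  have h := space_norm_sq q
  have hc := norm_mul_cos_polarAngle q
  have hs := Real.sin_sq_add_cos_sq (polarAngle q)
  have h1 : 0 ≤ Real.sin (polarAngle q) :=
    Real.sin_nonneg_of_nonneg_of_le_pi (Real.arccos_nonneg _) (Real.arccos_le_pi _)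
  have h2 : 0 ≤ axisDist q := Real.sqrt_nonneg _
  refine (sq_eq_sq₀ (mul_nonneg (norm_nonneg q) h1) h2).mp ?_
  rw [axisDist_sq]
  have h3 : ‖q‖ ^ 2 * Real.cos (polarAngle q) ^ 2 = q 2 ^ 2 := by rw [← mul_pow, hc]
  linear_combination ‖q‖ ^ 2 * hs + h - h3

lemma inner_eTheta (q : Space) : inner ℝ (eTheta q) q = 0 := by
  rw [inner_space]
  simp only [eTheta, PiLp.toLp_apply, Matrix.cons_val]
  have h0 := axisDist_mul_cos_azimuth q
  have h1 := axisDist_mul_sin_azimuth q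
  have h2 := norm_mul_cos_polarAngle q
  have h3 := norm_mul_sin_polarAngle q
  have h4 := Real.sin_sq_add_cos_sq (azimuth q)
  rw [← h0, ← h1, ← h2, ← h3]
  linear_combination (‖q‖ * Real.sin (polarAngle q) * Real.cos (polarAngle q)) * h4

lemma inner_ePhi (q : Space) : inner ℝ (ePhi q) q = 0 := by
  rw [inner_space]
  simp only [ePhi, PiLp.toLp_apply, Matrix.cons_val]
  rw [← axisDist_mul_cos_azimuth q, ← axisDist_mul_sin_azimuth q]
  ring

lemma cross_eTheta_ePhi {q : Space} (hq : q ≠ 0) : cross (eTheta q) (ePhi q) = eRadial q := by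
  have hn := norm_ne_zero_iff.mpr hq
  have h4 := Real.sin_sq_add_cos_sq (azimuth q)
  ext i
  rw [cross_apply]
  simp only [eRadial, PiLp.smul_apply, smul_eq_mul]
  rw [eq_inv_mul_iff_mul_eq₀ hn]
  fin_cases i <;> simp [eTheta, ePhi]
  · rw [← axisDist_mul_cos_azimuth q, ← norm_mul_sin_polarAngle q]
    ring
  · rw [← axisDist_mul_sin_azimuth q, ← norm_mul_sin_polarAngle q]
    ring
  · conv_rhs => rw [← norm_mul_cos_polarAngle q]
    linear_combination (‖q‖ * Real.cos (polarAngle q)) * h4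

/-- The azimuth jumps across a half plane, but the sines and cosines of both angles are quotients of
coordinates, `axisDist` and the norm, differentiable off the axis. -/
lemma differentiableAt_eTheta_ePhi {k : Space} (hk : k 0 ≠ 0 ∨ k 1 ≠ 0) :
    DifferentiableAt ℝ eTheta k ∧ DifferentiableAt ℝ ePhi k := by
  have hk0 : k ≠ 0 := by
    rintro rfl
    simp at hk
  have hpos : k 0 ^ 2 + k 1 ^ 2 ≠ 0 := by
    rcases hk with h | h <;> positivity
  have hax : axisDist k ≠ 0 := fun h => hpos (by rw [← axisDist_sq, h]; norm_num)
  have hap : ∀ i : Fin 3, DifferentiableAt ℝ (fun q : Space => q i) k := fun i => by fun_prop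
  have hnd : DifferentiableAt ℝ (fun q : Space => ‖q‖⁻¹) k :=
    (contDiffOn_inv_norm.contDiffAt (isOpen_compl_singleton.mem_nhds hk0)).differentiableAt
      (by simp)
  have had : DifferentiableAt ℝ axisDist k :=
    (((hap 0).pow 2).add ((hap 1).pow 2)).sqrt hpos
  have hev : ∀ᶠ q in nhds k, axisDist q ≠ 0 := had.continuousAt.eventually_ne hax
  have hev' : ∀ᶠ q in nhds k, ‖q‖ ≠ 0 :=
    continuous_norm.continuousAt.eventually_ne (norm_ne_zero_iff.mpr hk0)
  have hcφ : DifferentiableAt ℝ (fun q => Real.cos (azimuth q)) k := by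
    refine ((had.inv hax).mul (hap 0)).congr_of_eventuallyEq ?_
    filter_upwards [hev] with q hq
    exact (eq_inv_mul_iff_mul_eq₀ hq).mpr (axisDist_mul_cos_azimuth q)
  have hsφ : DifferentiableAt ℝ (fun q => Real.sin (azimuth q)) k := by
    refine ((had.inv hax).mul (hap 1)).congr_of_eventuallyEq ?_
    filter_upwards [hev] with q hq
    exact (eq_inv_mul_iff_mul_eq₀ hq).mpr (axisDist_mul_sin_azimuth q)
  have hcθ : DifferentiableAt ℝ (fun q => Real.cos (polarAngle q)) k := by
    refine (hnd.mul (hap 2)).congr_of_eventuallyEq ?_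
    filter_upwards [hev'] with q hq
    exact (eq_inv_mul_iff_mul_eq₀ hq).mpr (norm_mul_cos_polarAngle q)
  have hsθ : DifferentiableAt ℝ (fun q => Real.sin (polarAngle q)) k := by
    refine (hnd.mul had).congr_of_eventuallyEq ?_
    filter_upwards [hev'] with q hq
    exact (eq_inv_mul_iff_mul_eq₀ hq).mpr (norm_mul_sin_polarAngle q)
  constructor <;> rw [differentiableAt_euclidean] <;> intro i <;> fin_cases i
  · exact hcθ.mul hcφ
  · exact hcθ.mul hsφ
  · exact hsθ.neg
  · exact hsφ.neg
  · exact hcφ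
  · exact differentiableAt_const _

/-- `v ↦ u × v` as a continuous linear map. -/
noncomputable def crossL (u : Space) : Space →L[ℝ] Space :=
  LinearMap.toContinuousLinearMap
    { toFun := cross u
      map_add' := fun v w => by ext i; simp [cross_apply]; ring
      map_smul' := fun c v => by ext i; simp [cross_apply]; ring }

lemma crossL_apply (u v : Space) : crossL u v = cross u v := rfl

lemma inner_cross_self (u q : Space) : inner ℝ (cross u q) q = 0 := by
  rw [inner_space]
  simp [cross_apply]
  ring

lemma contDiff_cross (u : Space) : ContDiff ℝ ∞ (fun q => cross u q) := (crossL u).contDiff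

/-- Unlike the spherical frame, the fields `e_a × k` are smooth everywhere, so they are admissible
in `S2Flat`; they also define `orbital`. -/
lemma lieBracket_cross (k : Space) :
    VectorField.lieBracket ℝ (fun q => cross (basisVec 0) q) (fun q => cross (basisVec 1) q) k =
      -cross (basisVec 2) k := by
  have h : ∀ u : Space, fderiv ℝ (fun q => cross u q) k = crossL u := fun u => (crossL u).fderiv
  rw [VectorField.lieBracket, h, h, crossL_apply, crossL_apply]
  ext i
  fin_cases i <;> simp [cross_apply, basisVec]

end SphericalFields

/-! ### Evaluation on the polar axis -/

section PolarAxis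

variable {m : ℝ} {F : Type*} [NormedAddCommGroup F] [NormedSpace ℂ F]
  {E : momentumSpace m → Type*} [∀ k, NormedAddCommGroup (E k)]
  [∀ k, InnerProductSpace ℂ (E k)] [TopologicalSpace (TotalSpace F E)] [FiberBundle F E]

/-- Every vector of a fibre is the value of a smooth section. -/
lemma exists_smoothSection [FiniteDimensional ℂ F] [VectorBundle ℝ F E]
    [ContMDiffVectorBundle ∞ F E 𝓘(ℝ, Space)] (k : momentumSpace m) (v : E k) :
    ∃ ψ : ∀ k, E k, SmoothSection F ψ ∧ ψ k = v := by
  obtain ⟨s, hs, hsm⟩ := FiberBundle.exists_contMDiffOn_extend (k := ∞) 𝓘(ℝ, Space) F v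
  -- A bump function supported where the local extension of `v` is smooth turns it into a global
  -- smooth section.
  obtain ⟨f, -, hf⟩ := (SmoothBumpFunction.nhds_basis_tsupport (I := 𝓘(ℝ, Space)) k).mem_iff.mp
    (interior_mem_nhds.mpr hs)
  refine ⟨fun q => f q • FiberBundle.extend F v q, ?_, ?_⟩
  · have h := ContMDiffOn.smul_section_of_tsupport (ψ := f) (s := FiberBundle.extend F v)
      f.contMDiff.contMDiffOn isOpen_interior hf (hsm.mono interior_subset)
    exact h.contMDiffOn
  · change f k • FiberBundle.extend F v k = v
    rw [f.eq_one, one_smul, FiberBundle.extend_apply_self]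

namespace ParticleBundle

variable (B : ParticleBundle m F E)

/-- For `X = e_a × k` the vector `v_X` is the projection of `e_a` orthogonal to `k`; on the axis
this is `e_a`, or `0` for `a = 2`. -/
lemma rotationConnection_cross (a : Fin 3) (ψ : ∀ k, E k) {k : momentumSpace m}
    (h0 : (k : Space) 0 = 0) (h1 : (k : Space) 1 = 0) (hk : (k : Space) ≠ 0) :
    B.rotationConnection (fun q => cross (basisVec a) q) ψ k =
      if a = 2 then 0 else Complex.I • B.J a ψ k := by
  have hn : (k : Space) 2 ≠ 0 := fun h => (norm_sq_pos hk).ne' (by rw [h0, h1, h]; norm_num)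
  rw [B.rotationConnection_of_tangent (inner_cross_self _ _)]
  have hn' : (((k : Space) 2 : ℝ) : ℂ) ≠ 0 := Complex.ofReal_ne_zero.mpr hn
  fin_cases a <;> simp [Fin.sum_univ_three, tangentCoeff, cross_apply, basisVec, h0, h1] <;>
    field_simp

/-- The spin part at the points of the polar axis. -/
lemma spin_rotationConnection (a : Fin 3) (ψ : ∀ k, E k) {k : momentumSpace m}
    (h0 : (k : Space) 0 = 0) (h1 : (k : Space) 1 = 0) (hk : (k : Space) ≠ 0) :
    spin B.J B.rotationConnection a ψ k = if a = 2 then B.J 2 ψ k else 0 := by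
  rw [spin, orbital, B.rotationConnection_cross a ψ h0 h1 hk]
  split_ifs with h
  · rw [h, smul_zero, sub_zero]
  · rw [smul_smul, neg_mul, Complex.I_mul_I, neg_neg, one_smul, sub_self]

/-- On the axis `S₀` and `S₁` kill every section, including `S₁ ψ` and `S₀ ψ`, so the commutator
vanishes while `S₂` is `J₂`. -/
lemma J_two_eq_zero_of_isAngularMomentum_spin
    (h : IsAngularMomentum F (spin B.J B.rotationConnection)) {ψ : ∀ k, E k}
    (hψ : SmoothSection F ψ) {k : momentumSpace m}
    (h0 : (k : Space) 0 = 0) (h1 : (k : Space) 1 = 0) (hk : (k : Space) ≠ 0) :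
    B.J 2 ψ k = 0 := by
  have h2 := h 0 ψ hψ k hk
  simp only [zero_add, B.spin_rotationConnection _ _ h0 h1 hk] at h2
  simpa using h2.symm

variable [VectorBundle ℝ F E] [VectorBundle ℂ F E]

/-- On the axis `(e₀ × k) × (e₁ × k) = |k|² e₂`, so this curvature is `i J₂`. -/
lemma J_two_eq_zero_of_curvature {ψ : ∀ k, E k} (hψ : SmoothSection F ψ) {k : momentumSpace m}
    (h0 : (k : Space) 0 = 0) (h1 : (k : Space) 1 = 0) (hk : (k : Space) ≠ 0)
    (h : curvature B.rotationConnection (fun q => cross (basisVec 0) q)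
      (fun q => cross (basisVec 1) q) ψ k = 0) : B.J 2 ψ k = 0 := by
  have hn : (k : Space) 2 ≠ 0 := fun h => (norm_sq_pos hk).ne' (by rw [h0, h1, h]; norm_num)
  rw [B.curvature_rotationConnection (inner_cross_self _) (inner_cross_self _) hψ hk
    ((contDiff_cross _).differentiable (by simp) _)
    ((contDiff_cross _).differentiable (by simp) _)] at h
  have hk' : (k : Space) ≠ 0 := hk
  simpa [dotOp, Fin.sum_univ_three, cross_apply, basisVec, h0, h1, hn, hk'] using h

lemma J_two_eq_zero_of_s2Flat (h : S2Flat F B.rotationConnection) {ψ : ∀ k, E k}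
    (hψ : SmoothSection F ψ) {k : momentumSpace m}
    (h0 : (k : Space) 0 = 0) (h1 : (k : Space) 1 = 0) (hk : (k : Space) ≠ 0) :
    B.J 2 ψ k = 0 :=
  B.J_two_eq_zero_of_curvature hψ h0 h1 hk
    (h _ _ (contDiff_cross _).contDiffOn (contDiff_cross _).contDiffOn
      (fun k _ => inner_cross_self _ k) (fun k _ => inner_cross_self _ k) ψ hψ k hk)

/-- With `X = e₀ × k` and `Y = e₁ × k` one has `[X, Y] = -e₂ × k`, hence `[L₀, L₁] - i L₂ = -F(X,
Y)`. -/
lemma J_two_eq_zero_of_isAngularMomentum_orbital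
    (h : IsAngularMomentum F (orbital B.rotationConnection)) {ψ : ∀ k, E k}
    (hψ : SmoothSection F ψ) {k : momentumSpace m}
    (h0 : (k : Space) 0 = 0) (h1 : (k : Space) 1 = 0) (hk : (k : Space) ≠ 0) :
    B.J 2 ψ k = 0 := by
  refine B.J_two_eq_zero_of_curvature hψ h0 h1 hk ?_
  have h2 := h 0 ψ hψ k hk
  have hc : ∀ a (φ : ∀ k, E k), B.rotationConnection (fun q => cross (basisVec a) q)
      (fun q => -Complex.I • φ q) k =
        -Complex.I • B.rotationConnection (fun q => cross (basisVec a) q) φ k := by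
    intro a φ
    rw [B.rotationConnection_of_tangent (inner_cross_self _ _),
      B.rotationConnection_of_tangent (inner_cross_self _ _)]
    simp only [B.J_const_smul, Finset.smul_sum, smul_comm (-Complex.I)]
  have hneg : B.rotationConnection (VectorField.lieBracket ℝ (fun q => cross (basisVec 0) q)
      (fun q => cross (basisVec 1) q)) ψ k =
        -B.rotationConnection (fun q => cross (basisVec 2) q) ψ k := by
    rw [B.rotationConnection_of_tangent (inner_cross_self _ _),
      B.rotationConnection_of_tangent (by
        rw [lieBracket_cross, inner_neg_left, inner_cross_self, neg_zero])]
    simp only [tangentCoeff, lieBracket_cross, ← Finset.sum_neg_distrib, cross_apply,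
      PiLp.neg_apply]
    refine Finset.sum_congr rfl fun b _ => ?_
    push_cast
    module
  simp only [zero_add] at h2
  have e : ∀ a, orbital B.rotationConnection a ψ = fun q =>
      -Complex.I • B.rotationConnection (fun q => cross (basisVec a) q) ψ q := fun a => rfl
  rw [e, e, e] at h2
  simp only [orbital, hc, smul_smul] at h2
  rw [curvature, hneg]
  simp only [neg_mul, Complex.I_mul_I, mul_neg, neg_neg, neg_smul, one_smul] at h2
  rw [sub_neg_eq_add, ← h2]
  abel

end ParticleBundle

end PolarAxis

/-! ### Little groups and triviality of their action -/

section LittleGroups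

lemma exists_cos_sin_polar (x y : ℝ) : ∃ t : ℝ,
    Real.sqrt (x ^ 2 + y ^ 2) * Real.cos t = x ∧ Real.sqrt (x ^ 2 + y ^ 2) * Real.sin t = y := by
  refine ⟨Complex.arg ⟨x, y⟩, ?_⟩
  have h : Real.sqrt (x ^ 2 + y ^ 2) = ‖(⟨x, y⟩ : ℂ)‖ := by
    rw [Complex.norm_def, Complex.normSq_mk, sq, sq]
  rw [h]
  exact ⟨Complex.norm_mul_cos_arg _, Complex.norm_mul_sin_arg _⟩

/-- Every vector of `ℝ³` is rotated to the positive polar axis by some `R₁(s) R₂(t)`. -/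
lemma exists_rotation_to_axis (x y z : ℝ) : ∃ s t : ℝ, ∀ w : ℝ,
    (rotation 1 s * rotation 2 t).mat.mulVec ![w, x, y, z] =
      ![w, 0, 0, Real.sqrt (x ^ 2 + y ^ 2 + z ^ 2)] := by
  obtain ⟨t, hx, hy⟩ := exists_cos_sin_polar x y
  obtain ⟨s, hz, hρ⟩ := exists_cos_sin_polar z (Real.sqrt (x ^ 2 + y ^ 2))
  have e : z ^ 2 + Real.sqrt (x ^ 2 + y ^ 2) ^ 2 = x ^ 2 + y ^ 2 + z ^ 2 := by
    rw [Real.sq_sqrt (by positivity)]; ring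
  rw [e] at hz hρ
  have h1 := Real.sin_sq_add_cos_sq t
  have h2 := Real.sin_sq_add_cos_sq s
  -- Here `t` is the azimuth and `s` the polar angle: undoing `t` brings the vector into the half
  -- plane of the first and third axes, undoing `s` brings it to the axis.
  refine ⟨-s, -t, fun w => ?_⟩
  rw [PoincareGroup.mul_mat, ← Matrix.mulVec_mulVec]
  have e1 : (rotation 2 (-t)).mat.mulVec ![w, x, y, z] =
      ![w, Real.sqrt (x ^ 2 + y ^ 2), 0, z] := by
    set ρ := Real.sqrt (x ^ 2 + y ^ 2)
    ext i
    fin_cases i <;>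
      simp [rotation_mat, rotationMatrix, Matrix.mulVec, dotProduct, Fin.sum_univ_four]
    · rw [← hx, ← hy]; linear_combination ρ * h1
    · rw [← hx, ← hy]; ring
  rw [e1]
  set ρ := Real.sqrt (x ^ 2 + y ^ 2)
  set r := Real.sqrt (x ^ 2 + y ^ 2 + z ^ 2)
  ext i
  fin_cases i <;>
    simp [rotation_mat, rotationMatrix, Matrix.mulVec, dotProduct, Fin.sum_univ_four]
  · rw [← hz, ← hρ]; ring
  · rw [← hz, ← hρ]; linear_combination r * h2

lemma PoincareGroup.lorentz_entry (g : PoincareGroup) (i j : Fin 4) :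
    g.mat 0 i * g.mat 0 j - g.mat 1 i * g.mat 1 j - g.mat 2 i * g.mat 2 j
      - g.mat 3 i * g.mat 3 j = minkowski i j := by
  have h := ((mem_LorentzGroup _).mp g.lor.2).1
  change g.mat.transpose * minkowski * g.mat = minkowski at h
  conv_rhs => rw [← h]
  simp [Matrix.mul_apply, minkowski, Fin.sum_univ_four, Matrix.diagonal]
  ring

/-- A Lorentz transformation fixing the time axis and the polar axis is a rotation about the
polar axis. -/
lemma exists_eq_rotation_two {g : PoincareGroup} (hg : g.transl = 0)
    (h0 : g.mat.mulVec ![1, 0, 0, 0] = ![1, 0, 0, 0])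
    (h3 : g.mat.mulVec ![0, 0, 0, 1] = ![0, 0, 0, 1]) : ∃ t, g = rotation 2 t := by
  have c0 : ∀ i, g.mat i 0 = (![1, 0, 0, 0] : Fin 4 → ℝ) i := fun i => by
    rw [← congrFun h0 i]; simp [Matrix.mulVec, dotProduct, Fin.sum_univ_four]
  have c3 : ∀ i, g.mat i 3 = (![0, 0, 0, 1] : Fin 4 → ℝ) i := fun i => by
    rw [← congrFun h3 i]; simp [Matrix.mulVec, dotProduct, Fin.sum_univ_four]
  have a00 := c0 0
  have a10 := c0 1
  have a20 := c0 2
  have a30 := c0 3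
  have a03 := c3 0
  have a13 := c3 1
  have a23 := c3 2
  have a33 := c3 3
  simp only [Matrix.cons_val] at a00 a10 a20 a30 a03 a13 a23 a33
  have b01 := g.lorentz_entry 0 1
  have b02 := g.lorentz_entry 0 2
  have b31 := g.lorentz_entry 3 1
  have b32 := g.lorentz_entry 3 2
  have b11 := g.lorentz_entry 1 1
  have b12 := g.lorentz_entry 1 2
  have b22 := g.lorentz_entry 2 2
  simp [minkowski, Matrix.diagonal, a00, a10, a20, a30, a03, a13, a23, a33] at b01 b02 b31 b32
  simp [minkowski, Matrix.diagonal, b01, b02, b31, b32] at b11 b12 b22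
  have hdet : g.mat.det = 1 := g.lor.1.2
  have hm : g.mat = !![1, 0, 0, 0; 0, g.mat 1 1, g.mat 1 2, 0; 0, g.mat 2 1, g.mat 2 2, 0;
      0, 0, 0, 1] := by
    ext i j
    fin_cases i <;> fin_cases j <;> simp [a00, a10, a20, a30, a03, a13, a23, a33, b01, b02, b31, b32]
  rw [hm, det_block_one_three] at hdet
  -- For an orthogonal 2 by 2 block this is the sum of the squared entries minus twice the
  -- determinant, `2 - 2`.
  have hsq : (g.mat 1 1 - g.mat 2 2) ^ 2 + (g.mat 1 2 + g.mat 2 1) ^ 2 = 0 := by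
    linear_combination -b11 - b22 - 2 * hdet
  have p1 := sq_nonneg (g.mat 1 1 - g.mat 2 2)
  have p2 := sq_nonneg (g.mat 1 2 + g.mat 2 1)
  have e1 : g.mat 2 2 = g.mat 1 1 :=
    (sub_eq_zero.mp (pow_eq_zero_iff two_ne_zero |>.mp (by linarith))).symm
  have e2 : g.mat 1 2 = -g.mat 2 1 :=
    eq_neg_of_add_eq_zero_left (pow_eq_zero_iff two_ne_zero |>.mp (by linarith))
  obtain ⟨t, ht1, ht2⟩ := exists_cos_sin_polar (g.mat 1 1) (g.mat 2 1)
  have hs : g.mat 1 1 ^ 2 + g.mat 2 1 ^ 2 = 1 := by linear_combination -b11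
  rw [hs, Real.sqrt_one, one_mul] at ht1 ht2
  refine ⟨t, PoincareGroup.ext_mat hg ?_⟩
  rw [hm, rotation_mat, e1, e2, ← ht1, ← ht2]
  rfl

/-- The null rotations in the plane of the first axis, which fix the light-like vector
`(1, 0, 0, 1)`. -/
noncomputable def nullMatrix (a : ℝ) : Matrix (Fin 4) (Fin 4) ℝ :=
  !![1 + a ^ 2 / 2, a, 0, -(a ^ 2 / 2); a, 1, 0, -a; 0, 0, 1, 0; a ^ 2 / 2, a, 0, 1 - a ^ 2 / 2]

lemma nullMatrix_det (a : ℝ) : (nullMatrix a).det = 1 := by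
  simp [nullMatrix, Matrix.det_succ_row_zero, Fin.sum_univ_succ, Fin.succAbove]
  ring

lemma nullMatrix_mem (a : ℝ) :
    (⟨nullMatrix a, nullMatrix_det a⟩ : Matrix.SpecialLinearGroup (Fin 4) ℝ) ∈ LorentzGroup := by
  refine (mem_LorentzGroup _).mpr ⟨?_, ?_⟩
  · ext i j
    fin_cases i <;> fin_cases j <;>
      simp [nullMatrix, minkowski, Matrix.mul_apply, Fin.sum_univ_four, Matrix.diagonal] <;> ring
  · change 0 < 1 + a ^ 2 / 2
    positivity

/-- The null rotations as elements of the Poincare group. -/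
noncomputable def nullRotation (a : ℝ) : PoincareGroup :=
  ⟨0, ⟨⟨nullMatrix a, nullMatrix_det a⟩, nullMatrix_mem a⟩⟩

lemma nullRotation_mat (a : ℝ) : (nullRotation a).mat = nullMatrix a := rfl

lemma nullRotation_add (a b : ℝ) : nullRotation (a + b) = nullRotation a * nullRotation b := by
  refine PoincareGroup.ext_mat ?_ ?_
  · simp [PoincareGroup.mul_transl, nullRotation]
  · rw [PoincareGroup.mul_mat, nullRotation_mat, nullRotation_mat, nullRotation_mat]
    ext i j
    fin_cases i <;> fin_cases j <;> simp [nullMatrix, Matrix.mul_apply, Fin.sum_univ_four] <;> ring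

lemma nullRotation_inv (a : ℝ) : (nullRotation a)⁻¹ = nullRotation (-a) := by
  rw [inv_eq_iff_mul_eq_one, ← nullRotation_add, add_neg_cancel]
  refine PoincareGroup.ext_mat rfl ?_
  rw [PoincareGroup.one_mat, nullRotation_mat]
  ext i j
  fin_cases i <;> fin_cases j <;> simp [nullMatrix]

/-- Null rotations are commutators of a rotation and a null rotation. -/
lemma nullRotation_eq_commutator (a : ℝ) : nullRotation a =
    nullRotation (a / 2) * rotation 2 Real.pi * (nullRotation (a / 2))⁻¹
      * rotation 2 (-Real.pi) := by
  -- The half turn about the polar axis conjugates each of these null rotations to its inverse, so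
  -- the right side is the square of `nullRotation (a / 2)`.
  rw [nullRotation_inv]
  refine PoincareGroup.ext_mat ?_ ?_
  · simp [PoincareGroup.mul_transl, nullRotation, rotation_transl]
  · simp only [PoincareGroup.mul_mat, nullRotation_mat, rotation_mat]
    ext i j
    fin_cases i <;> fin_cases j <;>
      simp [nullMatrix, rotationMatrix, Matrix.mul_apply, Fin.sum_univ_four] <;> ring

/-- The conjugating quarter turn carries the polar axis to the axis with index `1`. -/
lemma rotation_one_eq_conj (s : ℝ) : rotation 1 s =
    rotation 0 (-(Real.pi / 2)) * rotation 2 s * (rotation 0 (-(Real.pi / 2)))⁻¹ := by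
  rw [rotation_inv]
  refine PoincareGroup.ext_mat ?_ ?_
  · simp [PoincareGroup.mul_transl, rotation_transl]
  · simp only [PoincareGroup.mul_mat, rotation_mat]
    ext i j
    fin_cases i <;> fin_cases j <;>
      simp [rotationMatrix, Matrix.mul_apply, Fin.sum_univ_four]

/-- Boosts along the polar axis commute with rotations about it; this moves triviality from axis
points to the rest momentum. -/
lemma rotation_two_eq_conj_boost (s t : ℝ) : rotation 2 t =
    boost 2 s * rotation 2 t * (boost 2 s)⁻¹ := by
  rw [eq_mul_inv_iff_mul_eq]
  refine PoincareGroup.ext_mat ?_ ?_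
  · simp [PoincareGroup.mul_transl, rotation_transl, boost_transl]
  · simp only [PoincareGroup.mul_mat, rotation_mat, boost_mat]
    ext i j
    fin_cases i <;> fin_cases j <;>
      simp [rotationMatrix, boostMatrix, Matrix.mul_apply, Fin.sum_univ_four]

variable {m : ℝ}

lemma mulVec_fourMomentum (g : PoincareGroup) (k : momentumSpace m) :
    g.mat.mulVec (fourMomentum m k) = fourMomentum m (g • k : momentumSpace m) :=
  (fourMomentum_spatial g k).1.symm

lemma eq_of_fourMomentum {k q : momentumSpace m}
    (h : ∀ i : Fin 3, fourMomentum m k i.succ = fourMomentum m q i.succ) : k = q := by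
  apply Subtype.ext
  ext i
  have := h i
  fin_cases i <;> simpa [fourMomentum] using this

lemma rotation_two_smul_of_axis {k : momentumSpace m} (h0 : (k : Space) 0 = 0)
    (h1 : (k : Space) 1 = 0) (t : ℝ) : rotation 2 t • k = k := by
  refine Subtype.ext ?_
  ext i
  rw [coe_smul_apply]
  fin_cases i <;> simp [rotation_mat, rotationMatrix, h0, h1]

lemma exists_rotation_smul_axis (k : momentumSpace m) : ∃ h : PoincareGroup, h.transl = 0 ∧
    ((h • k : momentumSpace m) : Space) 0 = 0 ∧ ((h • k : momentumSpace m) : Space) 1 = 0 ∧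
    ((h • k : momentumSpace m) : Space) 2 = ‖(k : Space)‖ := by
  obtain ⟨s, t, h⟩ := exists_rotation_to_axis ((k : Space) 0) ((k : Space) 1) ((k : Space) 2)
  have e := (mulVec_fourMomentum (rotation 1 s * rotation 2 t) k).symm.trans (h (energy m k))
  refine ⟨rotation 1 s * rotation 2 t, ?_, ?_, ?_, ?_⟩
  · simp [PoincareGroup.mul_transl, rotation_transl]
  · simpa [fourMomentum] using congrFun e 1
  · simpa [fourMomentum] using congrFun e 2
  · rw [← Real.sqrt_sq (norm_nonneg (k : Space)), space_norm_sq]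
    simpa [fourMomentum] using congrFun e 3

variable {F : Type*} [NormedAddCommGroup F] [NormedSpace ℂ F]
  {E : momentumSpace m → Type*} [∀ k, NormedAddCommGroup (E k)]
  [∀ k, InnerProductSpace ℂ (E k)] [TopologicalSpace (TotalSpace F E)] [FiberBundle F E]

namespace ParticleBundle

variable (B : ParticleBundle m F E)

/-- `g` fixes `k` and acts trivially on the fibre `E(k)`. -/
def ActsTriviallyAt (g : PoincareGroup) (k : momentumSpace m) : Prop :=
  ∃ hk : g • k = k, ∀ v : E k, B.act g k k hk v = v

variable {B}

lemma ActsTriviallyAt.mul {g h : PoincareGroup} {k : momentumSpace m}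
    (hg : B.ActsTriviallyAt g k) (hh : B.ActsTriviallyAt h k) : B.ActsTriviallyAt (g * h) k := by
  obtain ⟨hgk, hg⟩ := hg
  obtain ⟨hhk, hh⟩ := hh
  exact ⟨by rw [mul_smul, hhk, hgk], fun v => by
    rw [B.act_mul g h k k k hhk hgk, hh, hg]⟩

lemma ActsTriviallyAt.conj {g : PoincareGroup} {k : momentumSpace m}
    (hg : B.ActsTriviallyAt g k) (h : PoincareGroup) {k' : momentumSpace m} (hk : h • k = k') :
    B.ActsTriviallyAt (h * g * h⁻¹) k' := by
  obtain ⟨hgk, hg⟩ := hg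
  have h1 : h⁻¹ • k' = k := by rw [← hk, inv_smul_smul]
  refine ⟨by rw [mul_smul, h1, mul_smul, hgk, hk], fun v => ?_⟩
  rw [B.act_mul (h * g) h⁻¹ k' k k' h1 (by rw [mul_smul, hgk, hk]),
    B.act_mul h g k k k' hgk hk, hg, ← B.act_mul h h⁻¹ k' k k' h1 hk,
    B.act_congr (mul_inv_cancel h), B.act_one]

lemma ActsTriviallyAt.of_conj {g h : PoincareGroup} {k : momentumSpace m}
    (hg : B.ActsTriviallyAt (h * g * h⁻¹) (h • k)) : B.ActsTriviallyAt g k := by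
  have := hg.conj h⁻¹ (inv_smul_smul h k)
  simpa [mul_assoc] using this

/-- If `J₂` vanishes on the polar axis, the rotations about this axis act trivially there. -/
lemma actsTriviallyAt_rotation_two [FiniteDimensional ℂ F] [VectorBundle ℝ F E]
    [ContMDiffVectorBundle ∞ F E 𝓘(ℝ, Space)] {k : momentumSpace m} (h0 : (k : Space) 0 = 0)
    (h1 : (k : Space) 1 = 0) (hk : (k : Space) ≠ 0)
    (hJ : ∀ ψ : ∀ k, E k, SmoothSection F ψ → B.J 2 ψ k = 0) (t : ℝ) :
    B.ActsTriviallyAt (rotation 2 t) k := by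
  have hfix := rotation_two_smul_of_axis h0 h1
  refine ⟨hfix t, fun v => ?_⟩
  obtain ⟨ψ, hψ, rfl⟩ := exists_smoothSection (F := F) k v
  have hd : HasDerivAt (fun s => B.onSections (rotation 2 s) ψ k) 0 0 := by
    have h := hJ ψ hψ
    rw [J, smul_eq_zero_iff_right Complex.I_ne_zero] at h
    rw [← h]
    exact (B.differentiableAt_rotation 2 hψ k hk).hasDerivAt
  simp only [B.onSections_of_fixed _ ψ (hfix _)] at hd
  -- The rotations fix `k`, so they form a one-parameter group `U` on this fibre. From `U(u) = U(s)
  -- U(u - s)` the zero derivative at `0` spreads to every `s`.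
  have hd' : ∀ s, HasDerivAt (fun s => B.act (rotation 2 s) k k (hfix s) (ψ k)) 0 s := by
    intro s
    have h2 := (B.actL (rotation 2 s) k k (hfix s)).hasFDerivAt.comp_hasDerivAt 0 hd
    rw [map_zero] at h2
    have h3 := HasDerivAt.scomp_of_eq s h2 ((hasDerivAt_id s).sub_const s) (by simp)
    rw [smul_zero] at h3
    refine h3.congr_of_eventuallyEq (Filter.Eventually.of_forall fun u => ?_)
    simp only [Function.comp, id, actL_apply]
    rw [← B.act_mul _ _ k k k (hfix _) (hfix _)]
    exact B.act_congr (by rw [← rotation_add]; ring_nf) _ _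
  have hc := is_const_of_deriv_eq_zero (fun s => (hd' s).differentiableAt)
    (fun s => (hd' s).deriv) t 0
  rw [hc, B.act_congr (rotation_zero 2), B.act_one]

/-- The massless case: the little groups are generated, up to conjugation, by rotations about
the polar axis. -/
lemma actsTriviallyAt_of_massless (hm : m = 0)
    (hR : ∀ k : momentumSpace m, (k : Space) 0 = 0 → (k : Space) 1 = 0 → (k : Space) ≠ 0 → ∀ t,
      B.ActsTriviallyAt (rotation 2 t) k) {g : PoincareGroup} (hg : g.transl = 0)
    {k : momentumSpace m} (hk : g • k = k) : B.ActsTriviallyAt g k := by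
  obtain ⟨h, hh, h0, h1, h2⟩ := exists_rotation_smul_axis k
  refine ActsTriviallyAt.of_conj (h := h) ?_
  have hfix : (h * g * h⁻¹) • (h • k) = h • k := by
    rw [mul_smul, inv_smul_smul, mul_smul, hk]
  have htr : (h * g * h⁻¹).transl = 0 := by
    have : (h⁻¹).transl = 0 := by
      change -((h⁻¹).mat.mulVec h.transl) = 0
      rw [hh]; simp
    simp [PoincareGroup.mul_transl, hh, hg, this]
  have hr : 0 < ‖(k : Space)‖ := norm_pos_iff.mpr (k.2 hm)
  generalize h * g * h⁻¹ = g' at hfix htr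
  generalize h • k = k' at h0 h1 h2 hfix
  have hR' := hR k' h0 h1 (k'.2 hm)
  have hE : energy m (k' : Space) = (k' : Space) 2 := by
    have hm2 : m ^ 2 = 0 := by simp [hm]
    rw [energy, hm2, space_norm_sq, h0, h1, h2]
    simp
  have hp : ∀ f : PoincareGroup, f • k' = k' → f.mat.mulVec ![1, 0, 0, 1] = ![1, 0, 0, 1] := by
    intro f hf
    have e : fourMomentum m (k' : Space) = ‖(k : Space)‖ • ![1, 0, 0, 1] := by
      ext i; fin_cases i <;> simp [fourMomentum, hE, h0, h1, h2]
    have h3 := mulVec_fourMomentum f k'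
    rw [hf, e, Matrix.mulVec_smul] at h3
    exact smul_right_injective _ hr.ne' h3
  have hN : ∀ a, B.ActsTriviallyAt (nullRotation a) k' := by
    intro a
    rw [nullRotation_eq_commutator]
    refine ((hR' Real.pi).conj _ ?_).mul (hR' _)
    refine eq_of_fourMomentum fun i => ?_
    rw [← mulVec_fourMomentum, nullRotation_mat]
    fin_cases i <;> simp [nullMatrix, Matrix.mulVec, dotProduct, Fin.sum_univ_four, fourMomentum,
      hE, h0, h1] <;> ring
  -- The angle `t` turns the transverse part of the image of the time axis into the direction of
  -- index `1`, the plane of the null rotations; `a` is its length.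
  obtain ⟨t, ht1, ht2⟩ := exists_cos_sin_polar (g'.mat 1 0) (g'.mat 2 0)
  set a := Real.sqrt (g'.mat 1 0 ^ 2 + g'.mat 2 0 ^ 2)
  set f := rotation 2 (-t) * g' with hf
  have hfk : f • k' = k' := by rw [hf, mul_smul, hfix, rotation_two_smul_of_axis h0 h1]
  have hpf := hp f hfk
  have c0 : f.mat 0 0 + f.mat 0 3 = 1 := by
    simpa [Matrix.mulVec, dotProduct, Fin.sum_univ_four] using congrFun hpf 0
  have c1 : f.mat 1 0 + f.mat 1 3 = 0 := by
    simpa [Matrix.mulVec, dotProduct, Fin.sum_univ_four] using congrFun hpf 1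
  have c2 : f.mat 2 0 + f.mat 2 3 = 0 := by
    simpa [Matrix.mulVec, dotProduct, Fin.sum_univ_four] using congrFun hpf 2
  have c3 : f.mat 3 0 + f.mat 3 3 = 1 := by
    simpa [Matrix.mulVec, dotProduct, Fin.sum_univ_four] using congrFun hpf 3
  have hsc := Real.sin_sq_add_cos_sq t
  have u1 : f.mat 1 0 = a := by
    rw [hf, PoincareGroup.mul_mat]
    simp [rotation_mat, rotationMatrix, Matrix.mul_apply, Fin.sum_univ_four]
    rw [← ht1, ← ht2]
    linear_combination a * hsc
  have u2 : f.mat 2 0 = 0 := by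
    rw [hf, PoincareGroup.mul_mat]
    simp [rotation_mat, rotationMatrix, Matrix.mul_apply, Fin.sum_univ_four]
    rw [← ht1, ← ht2]
    ring
  -- Fixing `(1, 0, 0, 1)` and preserving the metric force the first column of `f` to be that of
  -- `nullRotation a`. Then `nullRotation (-a) * f` fixes the time axis and the null vector, hence
  -- the polar axis.
  have l00 := f.lorentz_entry 0 0
  have l03 := f.lorentz_entry 0 3
  simp [minkowski, Matrix.diagonal] at l00 l03
  rw [u1, u2] at l00
  have e13 : f.mat 1 3 = -a := by linarith
  have e23 : f.mat 2 3 = 0 := by linarith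
  have e03 : f.mat 0 3 = 1 - f.mat 0 0 := by linarith
  have e33 : f.mat 3 3 = 1 - f.mat 3 0 := by linarith
  rw [u1, u2, e13, e23, e03, e33] at l03
  have d1 : f.mat 0 0 = 1 + f.mat 3 0 := by linarith
  rw [d1] at l00
  have d2 : f.mat 3 0 = a ^ 2 / 2 := by linarith
  have e0 : (nullRotation (-a) * f).mat.mulVec ![1, 0, 0, 0] = ![1, 0, 0, 0] := by
    rw [PoincareGroup.mul_mat, nullRotation_mat]
    ext i
    fin_cases i <;> simp [nullMatrix, Matrix.mulVec, dotProduct, Fin.sum_univ_four,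
      Matrix.mul_apply, u1, u2, d1, d2] <;> ring
  have hpn := hp (nullRotation (-a) * f) (by rw [mul_smul, hfk, (hN _).1])
  have e3 : (nullRotation (-a) * f).mat.mulVec ![0, 0, 0, 1] = ![0, 0, 0, 1] := by
    have e : (![0, 0, 0, 1] : Fin 4 → ℝ) = ![1, 0, 0, 1] - ![1, 0, 0, 0] := by
      ext i; fin_cases i <;> simp
    rw [e, Matrix.mulVec_sub, hpn, e0]
  obtain ⟨s, hs⟩ := exists_eq_rotation_two (by
    simp [PoincareGroup.mul_transl, nullRotation, hf, rotation_transl, htr]) e0 e3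
  have hfin : g' = rotation 2 t * (nullRotation a * rotation 2 s) := by
    rw [← hs, hf, ← mul_assoc (nullRotation a), ← nullRotation_inv, mul_inv_cancel, one_mul,
      ← rotation_inv, mul_inv_cancel_left]
  rw [hfin]
  exact (hR' t).mul ((hN a).mul (hR' s))

/-- The massive case: the little groups are conjugate to the rotation group. -/
lemma actsTriviallyAt_of_massive (hm : 0 < m)
    (hR : ∀ k : momentumSpace m, (k : Space) 0 = 0 → (k : Space) 1 = 0 → (k : Space) ≠ 0 → ∀ t,
      B.ActsTriviallyAt (rotation 2 t) k) {g : PoincareGroup} (hg : g.transl = 0)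
    {k : momentumSpace m} (hk : g • k = k) : B.ActsTriviallyAt g k := by
  let o : momentumSpace m := ⟨0, fun h => absurd h hm.ne'⟩
  have ho : ∀ i : Fin 3, (o : Space) i = 0 := fun i => rfl
  have hEo : energy m (o : Space) = m := by
    simp [energy, o, Real.sqrt_sq hm.le]
  have hR2 : ∀ t, B.ActsTriviallyAt (rotation 2 t) o := by
    intro t
    -- `hR` says nothing at the origin, so triviality is taken at the axis point `boost 2 1 • o` and
    -- boosted back; any nonzero rapidity would do.
    rw [rotation_two_eq_conj_boost (-1)]
    refine (hR (boost 2 1 • o) ?_ ?_ ?_ t).conj _ ?_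
    · rw [coe_smul_apply]; simp [boost_mat, boostMatrix, ho]
    · rw [coe_smul_apply]; simp [boost_mat, boostMatrix, ho]
    · intro h
      have h2 : ((boost 2 1 • o : momentumSpace m) : Space) 2 = 0 := by rw [h]; rfl
      rw [coe_smul_apply] at h2
      simp [boost_mat, boostMatrix, ho, hEo, hm.ne', Real.sinh_eq_zero] at h2
    · rw [← boost_inv, inv_smul_smul]
  have hfix0 : ∀ f : PoincareGroup, f.IsRotation → f • o = o := by
    intro f hf
    refine Subtype.ext (norm_eq_zero.mp ?_)
    rw [hf.norm_smul]
    exact norm_zero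
  have hR1 : ∀ t, B.ActsTriviallyAt (rotation 1 t) o := by
    intro t
    rw [rotation_one_eq_conj]
    exact (hR2 t).conj _ (hfix0 _ (isRotation_rotation 0 _))
  obtain ⟨h, hh, h0, h1, h2⟩ := exists_rotation_smul_axis k
  obtain ⟨b, hb, hbk⟩ : ∃ b : PoincareGroup, b.transl = 0 ∧ b • k = o := by
    -- A momentum along the polar axis with `|k| = m sinh η` has rapidity `η`; the opposite boost
    -- brings it to rest.
    refine ⟨boost 2 (-Real.arsinh (‖(k : Space)‖ / m)) * h, ?_, ?_⟩
    · simp [PoincareGroup.mul_transl, boost_transl, hh]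
    rw [mul_smul]
    have hE : energy m (h • k : momentumSpace m) = m * Real.sqrt (1 + (‖(k : Space)‖ / m) ^ 2) := by
      rw [energy, space_norm_sq, h0, h1, h2]
      have e : m ^ 2 + (0 ^ 2 + 0 ^ 2 + ‖(k : Space)‖ ^ 2)
          = m ^ 2 * (1 + (‖(k : Space)‖ / m) ^ 2) := by
        field_simp
        ring
      rw [e, Real.sqrt_mul (sq_nonneg m), Real.sqrt_sq hm.le]
    refine Subtype.ext ?_
    ext i
    rw [coe_smul_apply, ho, hE, h0, h1, h2]
    fin_cases i <;> simp [boost_mat, boostMatrix, Real.cosh_arsinh]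
    field_simp
    ring
  refine ActsTriviallyAt.of_conj (h := b) ?_
  rw [hbk]
  have hfix : (b * g * b⁻¹) • o = o := by
    rw [← hbk, mul_smul, inv_smul_smul, mul_smul, hk]
  have htr : (b * g * b⁻¹).transl = 0 := by
    have : (b⁻¹).transl = 0 := by
      change -((b⁻¹).mat.mulVec b.transl) = 0
      rw [hb]; simp
    simp [PoincareGroup.mul_transl, hb, hg, this]
  generalize b * g * b⁻¹ = g' at hfix htr
  have h3 := mulVec_fourMomentum g' o
  have e : fourMomentum m (o : Space) = m • ![1, 0, 0, 0] := by
    ext i; fin_cases i <;> simp [fourMomentum, hEo, ho]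
  rw [hfix, e, Matrix.mulVec_smul] at h3
  have h4 : g'.mat.mulVec ![1, 0, 0, 0] = ![1, 0, 0, 0] := smul_right_injective _ hm.ne' h3
  have c0 : ∀ i, g'.mat i 0 = (![1, 0, 0, 0] : Fin 4 → ℝ) i := fun i => by
    rw [← congrFun h4 i]; simp [Matrix.mulVec, dotProduct, Fin.sum_univ_four]
  have b03 := g'.lorentz_entry 0 3
  have b33 := g'.lorentz_entry 3 3
  simp [minkowski, Matrix.diagonal, c0] at b03
  simp [minkowski, Matrix.diagonal, b03] at b33
  -- Euler angles: rotating the image of the polar axis under `g'` back to the polar axis leaves a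
  -- rotation about it.
  obtain ⟨s, t, hst⟩ := exists_rotation_to_axis (g'.mat 1 3) (g'.mat 2 3) (g'.mat 3 3)
  have hn : Real.sqrt (g'.mat 1 3 ^ 2 + g'.mat 2 3 ^ 2 + g'.mat 3 3 ^ 2) = 1 := by
    rw [Real.sqrt_eq_one]; linarith
  have h5 : g'.mat.mulVec ![0, 0, 0, 1] = ![0, g'.mat 1 3, g'.mat 2 3, g'.mat 3 3] := by
    ext i; fin_cases i <;> simp [Matrix.mulVec, dotProduct, Fin.sum_univ_four, b03]
  have h6 : (rotation 1 s * rotation 2 t).mat.mulVec ![1, 0, 0, 0] = ![1, 0, 0, 0] := by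
    rw [PoincareGroup.mul_mat]
    ext i
    fin_cases i <;> simp [rotation_mat, rotationMatrix, Matrix.mulVec, dotProduct,
      Fin.sum_univ_four, Matrix.mul_apply]
  obtain ⟨u, hu⟩ := exists_eq_rotation_two (g := rotation 1 s * rotation 2 t * g')
    (by simp [PoincareGroup.mul_transl, rotation_transl, htr])
    (by rw [PoincareGroup.mul_mat, ← Matrix.mulVec_mulVec, h4, h6])
    (by rw [PoincareGroup.mul_mat, ← Matrix.mulVec_mulVec, h5, hst, hn])
  have hfin : g' = rotation 2 (-t) * (rotation 1 (-s) * rotation 2 u) := by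
    rw [← hu, ← rotation_inv, ← rotation_inv]
    group
  rw [hfin]
  exact (hR2 _).mul ((hR1 _).mul (hR2 _))

/-- If `J₂` vanishes on the polar axis, the particle is scalar. -/
theorem isScalar_of_J_two_eq_zero [FiniteDimensional ℂ F] [VectorBundle ℝ F E]
    [ContMDiffVectorBundle ∞ F E 𝓘(ℝ, Space)] (hm : 0 ≤ m)
    (hJ : ∀ ψ : ∀ k, E k, SmoothSection F ψ → ∀ k : momentumSpace m, (k : Space) 0 = 0 →
      (k : Space) 1 = 0 → (k : Space) ≠ 0 → B.J 2 ψ k = 0) : B.IsScalar := by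
  have hR : ∀ k : momentumSpace m, (k : Space) 0 = 0 → (k : Space) 1 = 0 → (k : Space) ≠ 0 → ∀ t,
      B.ActsTriviallyAt (rotation 2 t) k := fun k h0 h1 hk t =>
    actsTriviallyAt_rotation_two h0 h1 hk (fun ψ hψ => hJ ψ hψ k h0 h1 hk) t
  intro L k hk v
  rcases hm.eq_or_lt with h | h
  · exact (actsTriviallyAt_of_massless h.symm hR rfl hk).2 v
  · exact (actsTriviallyAt_of_massive h hR rfl hk).2 v

end ParticleBundle

end LittleGroups

end Relativity

/-! ### The theorem -/

theorem theorem8 {m : ℝ} (hm : 0 ≤ m)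
    {F : Type*} [NormedAddCommGroup F] [NormedSpace ℂ F] [FiniteDimensional ℂ F]
    {E : momentumSpace m → Type*} [∀ k, NormedAddCommGroup (E k)]
    [∀ k, InnerProductSpace ℂ (E k)] [TopologicalSpace (TotalSpace F E)] [FiberBundle F E]
    [VectorBundle ℂ F E] [VectorBundle ℝ F E] [ContMDiffVectorBundle ∞ F E 𝓘(ℝ, Space)]
    (B : ParticleBundle m F E) :
    IsConnection F B.rotationConnection ∧
    (∀ ψ : ∀ k, E k, SmoothSection F ψ →
      ∀ k : momentumSpace m, ((k : Space) 0 ≠ 0 ∨ (k : Space) 1 ≠ 0) →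
        curvature B.rotationConnection eTheta ePhi ψ k
          = (Complex.I / ((‖(k : Space)‖ ^ 2 : ℝ) : ℂ)) • dotOp eRadial B.J ψ k) ∧
    (¬ B.IsScalar →
      ¬ S2Flat F B.rotationConnection ∧
      ¬ IsAngularMomentum F (orbital B.rotationConnection) ∧
      ¬ IsAngularMomentum F (spin B.J B.rotationConnection)) := by
  refine ⟨B.isConnection_rotationConnection, fun ψ hψ k hk => ?_, fun hs => ⟨fun h => hs ?_,
    fun h => hs ?_, fun h => hs ?_⟩⟩
  · have hk0 : (k : Space) ≠ 0 := by
      intro h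
      rw [h] at hk
      simp at hk
    obtain ⟨hX, hY⟩ := differentiableAt_eTheta_ePhi hk
    rw [B.curvature_rotationConnection inner_eTheta inner_ePhi hψ hk0 hX hY]
    simp only [dotOp, cross_eTheta_ePhi hk0, Complex.ofReal_pow]
  · exact ParticleBundle.isScalar_of_J_two_eq_zero hm fun ψ hψ k h0 h1 hk =>
      B.J_two_eq_zero_of_s2Flat h hψ h0 h1 hk
  · exact ParticleBundle.isScalar_of_J_two_eq_zero hm fun ψ hψ k h0 h1 hk =>
      B.J_two_eq_zero_of_isAngularMomentum_orbital h hψ h0 h1 hk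
  · exact ParticleBundle.isScalar_of_J_two_eq_zero hm fun ψ hψ k h0 h1 hk =>
      B.J_two_eq_zero_of_isAngularMomentum_spin h hψ h0 h1 hk
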